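/- **Notation.** For a group $G$ and a subgroup $H$ let $\mathrm C_G(H)$ be the centralizer of $H$ in $G$; $H$ is a *Howe subgroup* of $G$ if $\mathrm C_G(\mathrm C_G(H))=H$. For a subgroup $H$ of $\mathrm O(n)$ put $\mathrm CH=\mathrm C_{\mathrm O(n)}(H)$, $\mathrm SH=\mathrm{SO}(n)\cap H$ and $\mathrm MH=\mathrm C\,\mathrm C\,\mathrm SH$. A Howe subgroup $H$ of $\mathrm O(n)$ is *$\mathrm S$-admissible* if $\mathrm SH$ is a Howe subgroup of $\mathrm{SO}(n)$ and no Howe subgroup of $\mathrm O(n)$ that is strictly smaller than $H$ contains $\mathrm SH$. For $\mathbb K=\mathbb R,\mathbb C,\mathbb H$ of real dimension $\delta=1,2,4$ and integers $m,k\ge 1$ let $\mathrm I_{\mathbb K}(m)$ be the isometry group of the standard scalar product on $\mathbb K^m$, that is $\mathrm O(m)$, $\mathrm U(m)$, $\mathrm{Sp}(m)$, let $\varphi:\mathrm I_{\mathbb K}(m)\to\mathrm O(\delta m)$ be the embedding by restriction of scalars to $\mathbb R$, and let $\mathrm I_{\mathbb K}(m)_k=\{\varphi(a)\otimes 1_k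 : a\in \mathrm I_{\mathbb K}(m)\}\subseteq \mathrm O(\delta mk)$ (rank $m$, multiplicity $k$). A subgroup $H$ of $\mathrm O(n)$ *has the factors* $\mathrm I_{\mathbb K_1}(m_1)_{k_1},\dots,\mathrm I_{\mathbb K_r}(m_r)_{k_r}$ if $\sum_i\delta_i m_ik_i=n$ and $H$ is conjugate in $\mathrm O(n)$ to the block diagonal group $\mathrm I_{\mathbb K_1}(m_1)_{k_1}\times\cdots\times\mathrm I_{\mathbb K_r}(m_r)_{k_r}$. (Every Howe subgroup of $\mathrm O(n)$ has such factors, uniquely up to order.) Factors with $\mathbb K_i=\mathbb R$ are called $\mathrm O$-factors. A subgroup $H$ of $\mathrm O(n)$ belongs to * case (A) if it has a factor $\mathrm O(2)_k$ with $k$ odd and no other $\mathrm O$-factor of odd multiplicity; * case (B) if it has a double factor $\mathrm O(1)_k\times\mathrm O(1)_l$ with $k,l$ odd and no other $\mathrm O$-factor of odd multiplicity. **Proposition.** Let $n\geq 0$ be an integer. 1. $\mathrm S$ restricts to a bijection from the set of $\mathrm S$-admissible Howe subgroups of $\mathrm O(n)$ onto the set of Howe subgroups of $\mathrm{SO}(n)$.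 The inverse is given by $\mathrm M$. 2. If $n$ is even, a Howe subgroup $H$ of $\mathrm O(n)$ is $\mathrm S$-admissible if and only if neither $H$ nor $\mathrm CH$ belongs to case (A) or (B). 3. If $n$ is odd, $\mathrm S$ restricts to a bijection from the set of all Howe subgroups of $\mathrm O(n)$ onto the set of Howe subgroups of $\mathrm{SO}(n)$. Its inverse is given by $\tilde H\mapsto Z\cdot\tilde H$, where $Z$ is the center of $\mathrm O(n)$. The bijection preserves conjugacy: Howe subgroups $H,K$ of $\mathrm O(n)$ are conjugate in $\mathrm O(n)$ if and only if $\mathrm SH,\mathrm SK$ are conjugate in $\mathrm{SO}(n)$. -/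

import Mathlib

open scoped Matrix Kronecker Quaternion

namespace Howe

section General

variable {G : Type*} [Group G]

/-- A Howe subgroup of `G` is a subgroup that is equal to its double centralizer in `G`. -/
def IsHowe (H : Subgroup G) : Prop :=
  Subgroup.centralizer (Subgroup.centralizer (H : Set G) : Set G) = H

/-- Conjugacy of subgroups of `G`. -/
def IsConjSubgroup (H K : Subgroup G) : Prop :=
  ∃ g : G, H.map (MulAut.conj g).toMonoidHom = K

/-- The product `Z · H` of the center `Z` of `G` with the subgroup `H`.  As `Z` is normal, the
supremum of the two subgroups is their product, see `coe_centerMul`. -/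
def centerMul (H : Subgroup G) : Subgroup G := Subgroup.center G ⊔ H

theorem coe_centerMul (H : Subgroup G) (x : G) :
    x ∈ centerMul H ↔ ∃ z ∈ Subgroup.center G, ∃ h ∈ H, z * h = x :=
  Subgroup.mem_sup_of_normal_left

end General

/-- The orthogonal group `O(n)`, as a group. -/
abbrev O (n : ℕ) : Type := Matrix.orthogonalGroup (Fin n) ℝ

/-- The special orthogonal group `SO(n)`, as a subgroup of `O(n)`. -/
def SO (n : ℕ) : Subgroup (O n) where
  carrier := {a | (a : Matrix (Fin n) (Fin n) ℝ).det = 1}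
  mul_mem' {a b} ha hb := by
    simp only [Set.mem_ofPred_eq] at *
    simp [ha, hb]
  one_mem' := by simp
  inv_mem' {a} ha := by
    simp only [Set.mem_ofPred_eq] at *
    simp [Matrix.star_eq_conjTranspose, ha]

variable {n : ℕ}

/-- `C H`: the centralizer of `H` in `O(n)`. -/
def C (H : Subgroup (O n)) : Subgroup (O n) := Subgroup.centralizer (H : Set (O n))

/-- `S H`: the intersection of `H` with `SO(n)`. -/
def S (H : Subgroup (O n)) : Subgroup (O n) := SO n ⊓ H

/-- `M H`: the double centralizer in `O(n)` of the intersection of `H` with `SO(n)`. -/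
def M (H : Subgroup (O n)) : Subgroup (O n) := C (C (S H))

/-- `H` is (contained in `SO(n)` and) a Howe subgroup of the group `SO(n)`, i.e. equal to its double
centralizer taken inside `SO(n)`. -/
def IsHoweSO (H : Subgroup (O n)) : Prop :=
  H ≤ SO n ∧ IsHowe (H.subgroupOf (SO n))

/-- A Howe subgroup `H` of `O(n)` is S-admissible if `S H` is a Howe subgroup of `SO(n)` and no
Howe subgroup of `O(n)` strictly smaller than `H` contains `S H`. -/
def IsSAdmissible (H : Subgroup (O n)) : Prop :=
  IsHowe H ∧ IsHoweSO (S H) ∧ ¬ ∃ K : Subgroup (O n), IsHowe K ∧ S H ≤ K ∧ K < H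

/-! ### Factors of Howe subgroups -/

/-- The base fields `ℝ`, `ℂ`, `ℍ`. -/
inductive BaseField
  | real
  | complex
  | quaternion

/-- The real dimension of the base field. -/
def BaseField.dim : BaseField → ℕ
  | real => 1
  | complex => 2
  | quaternion => 4

/-- Field restriction of scalars from `ℂ` to `ℝ`. -/
def restrictC (z : ℂ) : Matrix (Fin 2) (Fin 2) ℝ :=
  !![z.re, z.im; -z.im, z.re]

/-- Field restriction of scalars from `ℍ` to `ℝ`: the composition of
`a₁ + a₂ j ↦ !![conj a₁, - conj a₂; a₂, a₁]` (for `a₁ a₂ : ℂ`) with `restrictC`, the latter applied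
to real and imaginary parts of the whole `2 × 2` matrix. -/
def restrictH (q : ℍ[ℝ]) : Matrix (Fin 4) (Fin 4) ℝ :=
  !![ q.re,  -q.imJ, -q.imI,  q.imK;
      q.imJ,  q.re,   q.imK,  q.imI;
      q.imI, -q.imK,  q.re,  -q.imJ;
     -q.imK, -q.imI,  q.imJ,  q.re]

/-- The isometry group of the standard scalar product on `𝕂 ^ m`, that is `O(m)`, `U(m)`, `Sp(m)`
for `𝕂 = ℝ, ℂ, ℍ`, embedded into the real matrices of size `(dim 𝕂) m` by field restriction, the
index `(s, i)` standing for position `i` in the block number `s`. -/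
def BaseField.isometries (m : ℕ) : (𝕂 : BaseField) →
    Set (Matrix (Fin 𝕂.dim × Fin m) (Fin 𝕂.dim × Fin m) ℝ)
  | real => {A | ∃ a ∈ unitary (Matrix (Fin m) (Fin m) ℝ),
      A = Matrix.of fun p q => a p.2 q.2}
  | complex => {A | ∃ a ∈ unitary (Matrix (Fin m) (Fin m) ℂ),
      A = Matrix.of fun p q => restrictC (a p.2 q.2) p.1 q.1}
  | quaternion => {A | ∃ a ∈ unitary (Matrix (Fin m) (Fin m) ℍ[ℝ]),
      A = Matrix.of fun p q => restrictH (a p.2 q.2) p.1 q.1}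

/-- The data of a factor `I_𝕂(m)_k`: the base field `𝕂`, the rank `m` and the multiplicity `k`. -/
structure Factor where
  base : BaseField
  rank : ℕ
  mult : ℕ
  rank_pos : 0 < rank
  mult_pos : 0 < mult

/-- Index set of the standard basis of `ℝ ^ (δ m) ⊗ ℝ ^ k`, where `δ = dim 𝕂`. -/
abbrev Factor.Index (F : Factor) : Type := (Fin F.base.dim × Fin F.rank) × Fin F.mult

/-- The matrices `φ(a) ⊗ 1_k` with `a ∈ I_𝕂(m)`, where `φ` is field restriction from `𝕂` to `ℝ`. -/
def Factor.matrices (F : Factor) : Set (Matrix F.Index F.Index ℝ) :=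
  {A | ∃ a ∈ F.base.isometries F.rank, A = a ⊗ₖ (1 : Matrix (Fin F.mult) (Fin F.mult) ℝ)}

/-- `H` is conjugate in `O(n)` to the group `F₁ × ⋯ × F_r` of all block diagonal matrices whose
`i`-th block ranges independently over the `i`-th factor. The bijection `e` orders the basis
vectors; its existence says that the sizes of the blocks add up to `n`. -/
def HasFactors (H : Subgroup (O n)) {r : ℕ} (F : Fin r → Factor) : Prop :=
  ∃ (e : (Σ i, (F i).Index) ≃ Fin n) (g : O n), ∀ x : O n,
    x ∈ H ↔ ∃ A : (i : Fin r) → Matrix (F i).Index (F i).Index ℝ,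
      (∀ i, A i ∈ (F i).matrices) ∧
        ((g⁻¹ * x * g : O n) : Matrix (Fin n) (Fin n) ℝ) =
          Matrix.reindex e e (Matrix.blockDiagonal' A)

/-- The factor is an `O`-factor of odd multiplicity. -/
def Factor.IsOddO (F : Factor) : Prop := F.base = BaseField.real ∧ Odd F.mult

/-- Case (A): `H` has a factor `O(2)_k` with `k` odd, and no other `O`-factor of `H` has odd
multiplicity. -/
def CaseA (H : Subgroup (O n)) : Prop :=
  ∃ (r : ℕ) (F : Fin r → Factor), HasFactors H F ∧
    ∃ i, (F i).IsOddO ∧ (F i).rank = 2 ∧ ∀ j, j ≠ i → ¬ (F j).IsOddO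

/-- Case (B): `H` has a double factor `O(1)_k × O(1)_l` with `k`, `l` odd, and no other `O`-factor
of `H` has odd multiplicity. -/
def CaseB (H : Subgroup (O n)) : Prop :=
  ∃ (r : ℕ) (F : Fin r → Factor), HasFactors H F ∧
    ∃ i i', i ≠ i' ∧ (F i).IsOddO ∧ (F i).rank = 1 ∧ (F i').IsOddO ∧ (F i').rank = 1 ∧
      ∀ j, j ≠ i → j ≠ i' → ¬ (F j).IsOddO

end Howe

/-! Write `C`, `S` for centralizers in O(n) and intersection with SO(n). The double centralizer of H
inside SO(n) is `S (C (S (C H)))`, and `C (C (S H))` is the smallest Howe subgroup of O(n)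
containing `S H`. A Howe subgroup H is therefore S-admissible iff `C (S H) = C H` and `S (C (S (C
H))) = S H` (`isSAdmissible_iff`). The first bijection is formal. For odd n the central element -1
has determinant -1, so `S` only forgets a factor ±1 that every Howe subgroup contains.

For even n the question is when `C (S H) = C H`, for H and for its centralizer. H consists of the
orthogonal matrices in the commutant of `C H`, a real *-algebra. Splitting 1 into minimal
projections, identifying each corner with ℝ, ℂ or ℍ, and choosing an adapted orthonormal basis gives
the factors of H (`IsHowe.exists_hasFactors`).

Only O-factors of odd multiplicity can have determinant -1 (`Factor.det_eq_one`). Let N be the sum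
of their ranks; each of the N coordinates gives a reflection in H of determinant -1. If N = 0, then
H lies in SO(n). If N ≥ 3, each reflection is a linear combination of 1 and products of two
reflections, so nothing is lost on passing to `S H` (`C_S_of_three`). N = 1 would make n odd. N = 2
is case (A) or (B); there a quarter turn in a plane centralizes `S H` but not H (`CaseA.S_C_S_ne`,
`CaseB.S_C_S_ne`). -/

namespace Howe

set_option linter.unusedSectionVars false

/-! ### Formal properties of centralizers and S-admissibility -/

section Centralizer

variable {n : ℕ}

theorem mem_C {H : Subgroup (O n)} {x : O n} : x ∈ C H ↔ ∀ h ∈ H, h * x = x * h :=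
  Subgroup.mem_centralizer_iff

theorem mem_S {H : Subgroup (O n)} {x : O n} : x ∈ S H ↔ x ∈ SO n ∧ x ∈ H := Subgroup.mem_inf

theorem C_anti {H K : Subgroup (O n)} (h : H ≤ K) : C K ≤ C H := Subgroup.centralizer_le h

theorem le_C_C (H : Subgroup (O n)) : H ≤ C (C H) := fun x hx =>
  mem_C.2 fun _ hh => (mem_C.1 hh x hx).symm

theorem C_C_C (H : Subgroup (O n)) : C (C (C H)) = C H :=
  le_antisymm (C_anti (le_C_C H)) (le_C_C _)

theorem isHowe_C (H : Subgroup (O n)) : IsHowe (C H) := C_C_C H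

theorem IsHowe.C_C {H : Subgroup (O n)} (h : IsHowe H) : C (C H) = H := h

theorem S_le (H : Subgroup (O n)) : S H ≤ H := inf_le_right

theorem S_mono {H K : Subgroup (O n)} (h : H ≤ K) : S H ≤ S K := inf_le_inf_left _ h

theorem S_of_le {H : Subgroup (O n)} (h : H ≤ SO n) : S H = H := inf_eq_right.2 h

/-- The double centralizer taken inside `SO(n)`, in terms of `S` and `C`. -/
theorem isHoweSO_iff {H : Subgroup (O n)} :
    IsHoweSO H ↔ H ≤ SO n ∧ S (C (S (C H))) = H := by
  refine and_congr_right fun hle => ?_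
  have key : ∀ x : SO n,
      x ∈ Subgroup.centralizer
        (Subgroup.centralizer (H.subgroupOf (SO n) : Set (SO n)) : Set (SO n)) ↔
      (x : O n) ∈ S (C (S (C H))) := by
    intro x
    simp only [Subgroup.mem_centralizer_iff, mem_S, mem_C, SetLike.mem_coe, Subgroup.mem_subgroupOf]
    constructor
    · intro h
      refine ⟨x.2, fun y hy => ?_⟩
      exact congrArg Subtype.val (h ⟨y, hy.1⟩ fun z hz => Subtype.ext (hy.2 z hz))
    · rintro ⟨-, h⟩ y hy
      exact Subtype.ext (h y ⟨y.2, fun z hz => congrArg Subtype.val (hy ⟨z, hle hz⟩ hz)⟩)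
  unfold IsHowe
  constructor
  · intro h
    ext x
    constructor
    · intro hx
      have := (key ⟨x, (mem_S.1 hx).1⟩).2 hx
      rwa [h] at this
    · intro hx
      refine (key ⟨x, hle hx⟩).1 ?_
      rw [h]
      exact hx
  · intro h
    ext x
    rw [key, h]
    rfl

/-- Centralizing the smaller group `S (C H)` only enlarges the result, so `S (C (C H))` is squeezed
between H and `S (C (S (C H))) = H`. -/
theorem S_C_C_of_isHoweSO {H : Subgroup (O n)} (h : IsHoweSO H) : S (C (C H)) = H := by
  obtain ⟨hle, h⟩ := isHoweSO_iff.1 h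
  apply le_antisymm
  · conv_rhs => rw [← h]
    exact S_mono (C_anti (S_le _))
  · exact fun x hx => mem_S.2 ⟨hle hx, le_C_C H hx⟩

/-- Since `C (C (S H))` is the smallest Howe subgroup containing `S H`, minimality of H means that
it equals H, which is the first equation. Given this, the second one says that `S H` is its own
double centralizer in SO(n). -/
theorem isSAdmissible_iff {H : Subgroup (O n)} (hH : IsHowe H) :
    IsSAdmissible H ↔ C (S H) = C H ∧ S (C (S (C H))) = S H := by
  constructor
  · rintro ⟨-, h2, h3⟩
    have h4 : C (S H) = C H := by
      have : C (C (S H)) = H := by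
        by_contra hne
        exact h3 ⟨C (C (S H)), isHowe_C _, le_C_C _,
          lt_of_le_of_ne ((C_anti (C_anti (S_le H))).trans hH.C_C.le) hne⟩
      rw [← C_C_C (S H), this]
    refine ⟨h4, ?_⟩
    have := (isHoweSO_iff.1 h2).2
    rwa [h4] at this
  · rintro ⟨h1, h2⟩
    refine ⟨hH, isHoweSO_iff.2 ⟨inf_le_left, by rw [h1, h2]⟩, ?_⟩
    rintro ⟨K, hK, hSK, hlt⟩
    refine hlt.not_ge ?_
    rw [← hH.C_C, ← h1, ← hK.C_C]
    exact C_anti (C_anti hSK)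

theorem M_S_of_isSAdmissible {H : Subgroup (O n)} (hH : IsSAdmissible H) : M (S H) = H := by
  rw [M, S_of_le (H := S H) inf_le_left, ((isSAdmissible_iff hH.1).1 hH).1, hH.1.C_C]

theorem S_M_of_isHoweSO {H : Subgroup (O n)} (hH : IsHoweSO H) : S (M H) = H := by
  rw [M, S_of_le hH.1, S_C_C_of_isHoweSO hH]

theorem isSAdmissible_M {H : Subgroup (O n)} (hH : IsHoweSO H) : IsSAdmissible (M H) := by
  have hM : M H = C (C H) := by rw [M, S_of_le hH.1]
  refine ⟨hM ▸ isHowe_C _, (S_M_of_isHoweSO hH).symm ▸ hH, ?_⟩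
  rintro ⟨K, hK, hSK, hlt⟩
  rw [S_M_of_isHoweSO hH] at hSK
  refine hlt.not_ge ?_
  rw [hM, ← hK.C_C]
  exact C_anti (C_anti hSK)

theorem bijOn_S_isSAdmissible (n : ℕ) :
    Set.BijOn S {H : Subgroup (O n) | IsSAdmissible H} {H : Subgroup (O n) | IsHoweSO H} ∧
      Set.InvOn M S {H : Subgroup (O n) | IsSAdmissible H} {H : Subgroup (O n) | IsHoweSO H} := by
  have hinv : Set.InvOn M S {H : Subgroup (O n) | IsSAdmissible H}
      {H : Subgroup (O n) | IsHoweSO H} :=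
    ⟨fun H hH => M_S_of_isSAdmissible hH, fun H hH => S_M_of_isHoweSO hH⟩
  exact ⟨hinv.bijOn (fun H hH => hH.2.1) (fun H hH => isSAdmissible_M hH), hinv⟩

theorem det_eq_one_or (x : O n) :
    (x : Matrix (Fin n) (Fin n) ℝ).det = 1 ∨ (x : Matrix (Fin n) (Fin n) ℝ).det = -1 := by
  have h := congrArg Matrix.det ((Matrix.mem_orthogonalGroup_iff (Fin n) ℝ).1 x.2)
  rw [Matrix.det_mul, Matrix.det_transpose, Matrix.det_one] at h
  exact mul_self_eq_one_iff.1 h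

theorem mem_SO {x : O n} : x ∈ SO n ↔ (x : Matrix (Fin n) (Fin n) ℝ).det = 1 := Iff.rfl

theorem mul_mem_SO {x y : O n} (hx : x ∉ SO n) (hy : y ∉ SO n) : x * y ∈ SO n := by
  rw [mem_SO] at *
  have h1 := (det_eq_one_or x).resolve_left hx
  have h2 := (det_eq_one_or y).resolve_left hy
  simp [h1, h2]

end Centralizer

/-! ### Odd dimension: the role of -1 -/

section OddDimension

variable {n : ℕ}

theorem neg_one_mem_center (n : ℕ) : (-1 : O n) ∈ Subgroup.center (O n) :=
  Subgroup.mem_center_iff.2 fun g => by simp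

theorem neg_one_notMem_SO (hn : Odd n) : (-1 : O n) ∉ SO n := by
  rw [mem_SO]
  change (-1 : Matrix (Fin n) (Fin n) ℝ).det ≠ 1
  rw [Matrix.det_neg, Fintype.card_fin, hn.neg_one_pow, Matrix.det_one]
  norm_num

theorem center_le_C (H : Subgroup (O n)) : Subgroup.center (O n) ≤ C H := fun _ hx =>
  mem_C.2 fun h _ => Subgroup.mem_center_iff.1 hx h

/-- One of x and -x has determinant 1, and both lie in H together. -/
theorem centerMul_S {H : Subgroup (O n)} (hn : Odd n) (hH : Subgroup.center (O n) ≤ H) :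
    centerMul (S H) = H := by
  apply le_antisymm (sup_le hH (S_le H))
  refine fun x hx => (coe_centerMul (S H) x).2 ?_
  by_cases hxs : x ∈ SO n
  · exact ⟨1, one_mem _, x, mem_S.2 ⟨hxs, hx⟩, one_mul x⟩
  · have hz := neg_one_mem_center n
    exact ⟨-1, hz, -1 * x,
      mem_S.2 ⟨mul_mem_SO (neg_one_notMem_SO hn) hxs, mul_mem (hH hz) hx⟩, by simp⟩

theorem C_centerMul (H : Subgroup (O n)) : C (centerMul H) = C H := by
  apply le_antisymm (C_anti le_sup_right)
  intro x hx
  refine mem_C.2 fun y hy => ?_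
  obtain ⟨z, hz, h, hh, rfl⟩ := (coe_centerMul H y).1 hy
  rw [mul_assoc, mem_C.1 hx h hh, ← mul_assoc, ← Subgroup.mem_center_iff.1 hz x, mul_assoc]

theorem C_S_of_odd {H : Subgroup (O n)} (hn : Odd n) (hH : Subgroup.center (O n) ≤ H) :
    C (S H) = C H := by
  rw [← C_centerMul (S H), centerMul_S hn hH]

theorem center_le_of_isHowe {H : Subgroup (O n)} (hH : IsHowe H) : Subgroup.center (O n) ≤ H :=
  hH.C_C ▸ center_le_C _

theorem isHoweSO_S_of_odd {H : Subgroup (O n)} (hn : Odd n) (hH : IsHowe H) : IsHoweSO (S H) := by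
  refine isHoweSO_iff.2 ⟨inf_le_left, ?_⟩
  rw [C_S_of_odd hn (center_le_of_isHowe hH), C_S_of_odd hn (center_le_C H), hH.C_C]

theorem S_centerMul_of_isHoweSO {H : Subgroup (O n)} (hH : IsHoweSO H) : S (centerMul H) = H := by
  obtain ⟨hle, h⟩ := isHoweSO_iff.1 hH
  refine le_antisymm (fun x hx => ?_) fun x hx => mem_S.2 ⟨hle hx, (le_sup_right : H ≤ _) hx⟩
  obtain ⟨hx1, hx⟩ := mem_S.1 hx
  rw [← h]
  refine mem_S.2 ⟨hx1, (sup_le (center_le_C _) ?_ : centerMul H ≤ _) hx⟩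
  exact (le_C_C H).trans (C_anti (S_le _))

/-- The chain is C(C(Z·H)) = C(C H) = C(S(C H)) = Z·S(C(S(C H))) = Z·H; the two middle equalities
use that n is odd. -/
theorem isHowe_centerMul {H : Subgroup (O n)} (hn : Odd n) (hH : IsHoweSO H) :
    IsHowe (centerMul H) := by
  obtain ⟨hle, h⟩ := isHoweSO_iff.1 hH
  change C (C (centerMul H)) = _
  rw [C_centerMul, ← C_S_of_odd hn (center_le_C H), ← centerMul_S hn (center_le_C (S (C H))), h]

theorem mem_map_conj {G : Type*} [Group G] {H : Subgroup G} {g x : G} :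
    x ∈ H.map (MulAut.conj g).toMonoidHom ↔ g⁻¹ * x * g ∈ H := by
  rw [Subgroup.mem_map]
  constructor
  · rintro ⟨y, hy, rfl⟩
    simpa [mul_assoc] using hy
  · intro h
    exact ⟨_, h, by simp [mul_assoc]⟩

theorem isConjSubgroup_iff {G : Type*} [Group G] {H K : Subgroup G} :
    IsConjSubgroup H K ↔ ∃ g : G, ∀ x, g⁻¹ * x * g ∈ H ↔ x ∈ K := by
  unfold IsConjSubgroup
  simp_rw [SetLike.ext_iff, mem_map_conj]

theorem conj_mem_SO (g x : O n) : g⁻¹ * x * g ∈ SO n ↔ x ∈ SO n := by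
  rw [mem_SO, mem_SO, Submonoid.coe_mul, Submonoid.coe_mul, Matrix.det_mul_right_comm,
    ← Submonoid.coe_mul, inv_mul_cancel, Submonoid.coe_one, one_mul]

/-- Conjugation by g and by -g agree, so a conjugating element may be taken in SO(n). Conversely,
membership of an x outside SO(n) is tested on -x. -/
theorem isConjSubgroup_S_iff {H K : Subgroup (O n)} (hn : Odd n) (hH : IsHowe H) (hK : IsHowe K) :
    IsConjSubgroup H K ↔ IsConjSubgroup ((S H).subgroupOf (SO n)) ((S K).subgroupOf (SO n)) := by
  rw [isConjSubgroup_iff, isConjSubgroup_iff]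
  have hz := neg_one_mem_center n
  constructor
  · rintro ⟨g, hg⟩
    obtain ⟨g, hgs, hg⟩ : ∃ g ∈ SO n, ∀ x, g⁻¹ * x * g ∈ H ↔ x ∈ K := by
      by_cases hgs : g ∈ SO n
      · exact ⟨g, hgs, hg⟩
      · refine ⟨-1 * g, mul_mem_SO (neg_one_notMem_SO hn) hgs, fun x => ?_⟩
        rw [← hg]
        have : (-1 * g)⁻¹ * x * (-1 * g) = g⁻¹ * x * g := by
          rw [neg_one_mul, show (-g)⁻¹ = -g⁻¹ from inv_eq_of_mul_eq_one_left (by simp)]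
          simp
        rw [this]
    refine ⟨⟨g, hgs⟩, fun x => ?_⟩
    simp only [Subgroup.mem_subgroupOf, mem_S, Subgroup.coe_mul, Subgroup.coe_inv,
      conj_mem_SO, hg]
  · rintro ⟨g, hg⟩
    refine ⟨g, fun x => ?_⟩
    have hSO : ∀ x ∈ SO n, ((g : O n)⁻¹ * x * g ∈ H ↔ x ∈ K) := fun x hx => by
      simpa only [Subgroup.mem_subgroupOf, mem_S, Subgroup.coe_mul, Subgroup.coe_inv,
        conj_mem_SO, hx, true_and] using hg ⟨x, hx⟩
    by_cases hx : x ∈ SO n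
    · exact hSO x hx
    · have h := hSO (-1 * x) (mul_mem_SO (neg_one_notMem_SO hn) hx)
      rw [Subgroup.mul_mem_cancel_left K (center_le_of_isHowe hK hz)] at h
      rw [← h, ← Subgroup.mul_mem_cancel_left H (center_le_of_isHowe hH hz)]
      simp

theorem bijOn_S_isHowe (hn : Odd n) :
    Set.BijOn S {H : Subgroup (O n) | IsHowe H} {H : Subgroup (O n) | IsHoweSO H} ∧
      Set.InvOn centerMul S {H : Subgroup (O n) | IsHowe H} {H : Subgroup (O n) | IsHoweSO H} := by
  have hinv : Set.InvOn centerMul S {H : Subgroup (O n) | IsHowe H}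
      {H : Subgroup (O n) | IsHoweSO H} :=
    ⟨fun H hH => centerMul_S hn (center_le_of_isHowe hH), fun H hH => S_centerMul_of_isHoweSO hH⟩
  exact ⟨hinv.bijOn (fun H hH => isHoweSO_S_of_odd hn hH) (fun H hH => isHowe_centerMul hn hH),
    hinv⟩

end OddDimension

/-! ### Minimal projections in real matrix *-algebras -/

section MinimalProjections

variable {ι : Type*} [Fintype ι] [DecidableEq ι]

theorem isStarProjection_iff_transpose {p : Matrix ι ι ℝ} :
    IsStarProjection p ↔ p * p = p ∧ pᵀ = p := by
  rw [isStarProjection_iff]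
  rfl

theorem rank_lt_of_mul_eq {p q : Matrix ι ι ℝ} (hq : q * q = q) (hpq : p * q = q)
    (hqp : q * p = q) (hne : q ≠ p) : q.rank < p.rank := by
  have hle : LinearMap.range q.mulVecLin ≤ LinearMap.range p.mulVecLin := by
    rintro _ ⟨v, rfl⟩
    exact ⟨q *ᵥ v, by simp [hpq]⟩
  refine Submodule.finrank_lt_finrank_of_lt (lt_of_le_of_ne hle fun heq => hne ?_)
  rw [← hqp]
  refine Matrix.toLin'.injective (LinearMap.ext fun v => ?_)
  have hv : p *ᵥ v ∈ LinearMap.range q.mulVecLin := heq ▸ ⟨v, rfl⟩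
  obtain ⟨w, hw⟩ := hv
  have hw : q *ᵥ w = p *ᵥ v := hw
  simp only [Matrix.toLin'_apply, ← Matrix.mulVec_mulVec, ← hw]
  rw [Matrix.mulVec_mulVec, hq]

/-- A minimal star projection of an algebra of real matrices. -/
structure IsMinProj (𝒜 : StarSubalgebra ℝ (Matrix ι ι ℝ)) (p : Matrix ι ι ℝ) : Prop where
  mem : p ∈ 𝒜
  proj : IsStarProjection p
  ne_zero : p ≠ 0
  minimal : ∀ q ∈ 𝒜, IsStarProjection q → q * p = q → q ≠ 0 → q = p

theorem IsStarProjection.comm_of_mul_eq {p q : Matrix ι ι ℝ} (hp : IsStarProjection p)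
    (hq : IsStarProjection q) (h : q * p = q) : p * q = q := by
  have := congrArg star h
  rwa [star_mul, hp.isSelfAdjoint.star_eq, hq.isSelfAdjoint.star_eq] at this

theorem IsStarProjection.comm_of_mul_eq' {p q : Matrix ι ι ℝ} (hp : IsStarProjection p)
    (hq : IsStarProjection q) (h : p * q = q) : q * p = q := by
  have := congrArg star h
  rwa [star_mul, hp.isSelfAdjoint.star_eq, hq.isSelfAdjoint.star_eq] at this

/-- Induction on the rank: a nonzero p that is not minimal splits as q + (p - q) with both summands
nonzero and of smaller rank. The two families of pieces are mutually orthogonal because q (p - q) =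
0. -/
theorem exists_isMinProj_sum (𝒜 : StarSubalgebra ℝ (Matrix ι ι ℝ)) (p : Matrix ι ι ℝ) (hp𝒜 : p ∈ 𝒜)
    (hp : IsStarProjection p) :
    ∃ (κ : Type) (_ : Fintype κ) (f : κ → Matrix ι ι ℝ), (∀ i, IsMinProj 𝒜 (f i)) ∧
      (∀ i j, i ≠ j → f i * f j = 0) ∧ ∑ i, f i = p := by
  induction hr : p.rank using Nat.strong_induction_on generalizing p with
  | _ r ih =>
  subst hr
  by_cases h0 : p = 0
  · exact ⟨Empty, inferInstance, Empty.elim, fun i => i.elim, fun i => i.elim, by simp [h0]⟩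
  by_cases hmin : IsMinProj 𝒜 p
  · exact ⟨Unit, inferInstance, fun _ => p, fun _ => hmin, fun i j h => (h rfl).elim, by simp⟩
  obtain ⟨q, hq𝒜, hq, hqp, hq0, hne⟩ : ∃ q ∈ 𝒜, IsStarProjection q ∧ q * p = q ∧ q ≠ 0 ∧ q ≠ p := by
    by_contra! hcon
    exact hmin ⟨hp𝒜, hp, h0, fun q h1 h2 h3 h4 => hcon q h1 h2 h3 h4⟩
  have hpq := IsStarProjection.comm_of_mul_eq hp hq hqp
  have hq' : IsStarProjection (p - q) := hq.sub_of_mul_eq_left hp hqp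
  have hpp : p * p = p := hp.isIdempotentElem
  have hqq : q * q = q := hq.isIdempotentElem
  obtain ⟨κ₁, _, f₁, h1, h1', h1s⟩ := ih _ (rank_lt_of_mul_eq hqq hpq hqp hne) q hq𝒜 hq rfl
  obtain ⟨κ₂, _, f₂, h2, h2', h2s⟩ := ih _ (rank_lt_of_mul_eq hq'.isIdempotentElem
    (by rw [mul_sub, hpp, hpq]) (by rw [sub_mul, hpp, hqp]) (by simpa using hq0)) (p - q)
    (sub_mem hp𝒜 hq𝒜) hq' rfl
  -- Each piece is absorbed by the sum of its family.
  have hf : ∀ {κ : Type} [Fintype κ] (f : κ → Matrix ι ι ℝ) (s : Matrix ι ι ℝ),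
      (∀ i, IsMinProj 𝒜 (f i)) → (∀ i j, i ≠ j → f i * f j = 0) → ∑ i, f i = s →
      ∀ i, f i * s = f i ∧ s * f i = f i := by
    intro κ _ f s h h' hs i
    classical
    rw [← hs, Finset.mul_sum, Finset.sum_mul,
      Finset.sum_eq_single_of_mem i (Finset.mem_univ _) fun j _ hj => h' i j hj.symm,
      Finset.sum_eq_single_of_mem i (Finset.mem_univ _) fun j _ hj => h' j i hj]
    exact ⟨(h i).proj.isIdempotentElem, (h i).proj.isIdempotentElem⟩
  have c1 := hf f₁ q h1 h1' h1s
  have c2 := hf f₂ _ h2 h2' h2s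
  refine ⟨κ₁ ⊕ κ₂, inferInstance, Sum.elim f₁ f₂, ?_, ?_, by simp [h1s, h2s]⟩
  · rintro (i | i)
    exacts [h1 i, h2 i]
  · rintro (i | i) (j | j) hij
    · exact h1' i j fun h => hij (h ▸ rfl)
    · change f₁ i * f₂ j = 0
      rw [← (c1 i).1, ← (c2 j).2, mul_assoc, ← mul_assoc q, mul_sub, hqp, hqq, sub_self, zero_mul,
        mul_zero]
    · change f₂ i * f₁ j = 0
      rw [← (c2 i).1, ← (c1 j).2, mul_assoc, ← mul_assoc (p - q), sub_mul, hpq, hqq, sub_self,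
        zero_mul, mul_zero]
    · exact h2' i j fun h => hij (h ▸ rfl)

theorem cfc_mem_of_starSubalgebra (𝒜 : StarSubalgebra ℝ (Matrix ι ι ℝ)) {a : Matrix ι ι ℝ}
    (ha : a ∈ 𝒜) (f : ℝ → ℝ) : cfc f a ∈ 𝒜 := by
  have hs : IsClosed (𝒜 : Set (Matrix ι ι ℝ)) :=
    Submodule.closed_of_finiteDimensional 𝒜.toSubalgebra.toSubmodule
  exact cfc_mem f ha

/-- The spectral projection of a at an eigenvalue c ≠ 0 lies in 𝒜 and below p, so it equals p by
minimality; hence a = a p = c p. -/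
theorem IsMinProj.exists_smul {𝒜 : StarSubalgebra ℝ (Matrix ι ι ℝ)} {p a : Matrix ι ι ℝ}
    (hp : IsMinProj 𝒜 p) (ha : a ∈ 𝒜) (hsa : aᵀ = a) (hap : a * p = a) : ∃ c : ℝ, a = c • p := by
  have hsa' : IsSelfAdjoint a := hsa
  by_cases ha0 : a = 0
  · exact ⟨0, by simp [ha0]⟩
  have hfin : (spectrum ℝ a).Finite := Matrix.finite_real_spectrum
  have hcont : ∀ f : ℝ → ℝ, ContinuousOn f (spectrum ℝ a) := fun f => hfin.continuousOn f
  obtain ⟨c, hc, hc0⟩ : ∃ c ∈ spectrum ℝ a, c ≠ 0 := by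
    by_contra! hcon
    apply ha0
    rw [← cfc_id' ℝ a, cfc_congr (g := fun _ => 0) fun x hx => hcon x hx, cfc_const_zero]
  -- The indicator function of c; `cfc f a` is the spectral projection.
  set f : ℝ → ℝ := fun x => if x = c then 1 else 0 with hf
  have hqa : a * cfc f a = c • cfc f a := by
    rw [← cfc_const_mul c f a (hcont _)]
    conv_lhs => enter [1]; rw [← cfc_id' ℝ a]
    rw [← cfc_mul _ _ a (hcont _) (hcont _)]
    refine cfc_congr fun x _ => ?_
    by_cases hx : x = c <;> simp [hf, hx]
  have hcomm : cfc f a * a = a * cfc f a := (hsa'.commute_cfc (Commute.refl a) f).eq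
  have hq : IsStarProjection (cfc f a) := by
    refine ⟨?_, cfc_predicate f a⟩
    rw [IsIdempotentElem, ← cfc_mul _ _ a (hcont _) (hcont _)]
    refine cfc_congr fun x _ => ?_
    by_cases hx : x = c <;> simp [hf, hx]
  have hqp : cfc f a * p = cfc f a := by
    have h1 : cfc f a = c⁻¹ • (cfc f a * a) := by
      rw [hcomm, hqa, smul_smul, inv_mul_cancel₀ hc0, one_smul]
    conv_lhs => rw [h1]
    rw [smul_mul_assoc, mul_assoc, hap, ← h1]
  have hq0 : cfc f a ≠ 0 := by
    intro h0
    rw [← cfc_const_zero ℝ a, cfc_eq_cfc_iff_eqOn hsa' (hcont _) (hcont _)] at h0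
    simpa [hf] using h0 hc
  have := hp.minimal _ (cfc_mem_of_starSubalgebra 𝒜 ha f) hq hqp hq0
  rw [this, hap] at hqa
  exact ⟨c, hqa⟩

theorem transpose_mul_self_ne_zero {a : Matrix ι ι ℝ} (ha : a ≠ 0) : aᵀ * a ≠ 0 := by
  rwa [← Matrix.conjTranspose_eq_transpose_of_trivial, Ne, Matrix.conjTranspose_mul_self_eq_zero]

theorem trace_transpose_mul_self_nonneg (a : Matrix ι ι ℝ) : 0 ≤ (aᵀ * a).trace := by
  simp only [Matrix.trace, Matrix.diag, Matrix.mul_apply, Matrix.transpose_apply]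
  exact Finset.sum_nonneg fun i _ => Finset.sum_nonneg fun j _ => mul_self_nonneg _

theorem IsMinProj.transpose {𝒜 : StarSubalgebra ℝ (Matrix ι ι ℝ)} {p : Matrix ι ι ℝ}
    (hp : IsMinProj 𝒜 p) : pᵀ = p := hp.proj.isSelfAdjoint

theorem IsMinProj.mul_self {𝒜 : StarSubalgebra ℝ (Matrix ι ι ℝ)} {p : Matrix ι ι ℝ}
    (hp : IsMinProj 𝒜 p) : p * p = p := hp.proj.isIdempotentElem

theorem transpose_mem {𝒜 : StarSubalgebra ℝ (Matrix ι ι ℝ)} {a : Matrix ι ι ℝ} (ha : a ∈ 𝒜) :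
    aᵀ ∈ 𝒜 := star_mem ha

/-- A nonzero element `y` with `y = y p` satisfies `yᵀ y = c p` with `c > 0`. -/
theorem IsMinProj.exists_pos_smul {𝒜 : StarSubalgebra ℝ (Matrix ι ι ℝ)} {p y : Matrix ι ι ℝ}
    (hp : IsMinProj 𝒜 p) (hy : y ∈ 𝒜) (hyp : y * p = y) (hy0 : y ≠ 0) :
    ∃ c : ℝ, 0 < c ∧ yᵀ * y = c • p := by
  obtain ⟨c, hc⟩ := hp.exists_smul (mul_mem (transpose_mem hy) hy)
    (by simp) (by rw [mul_assoc, hyp])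
  refine ⟨c, ?_, hc⟩
  have hc0 : c ≠ 0 := fun h => transpose_mul_self_ne_zero hy0 (by rw [hc, h, zero_smul])
  have h1 := trace_transpose_mul_self_nonneg y
  have h2 := trace_transpose_mul_self_nonneg p
  rw [hp.transpose, hp.mul_self] at h2
  rw [hc, Matrix.trace_smul, smul_eq_mul] at h1
  rcases h2.lt_or_eq with h2 | h2
  · exact lt_of_le_of_ne (le_of_mul_le_mul_right (by simpa using h1) h2) hc0.symm
  -- A projection of trace 0 vanishes, since its trace is its squared Frobenius norm.
  · exfalso
    have h3 : (pᴴ * p).trace = 0 := by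
      rw [Matrix.conjTranspose_eq_transpose_of_trivial, hp.transpose, hp.mul_self, h2]
    exact hp.ne_zero (Matrix.trace_conjTranspose_mul_self_eq_zero_iff.1 h3)

/-- Minimal projections that are linked by a nonzero element are linked by a partial isometry. -/
theorem IsMinProj.exists_partial_isometry {𝒜 : StarSubalgebra ℝ (Matrix ι ι ℝ)}
    {p q y : Matrix ι ι ℝ} (hp : IsMinProj 𝒜 p) (hq : IsMinProj 𝒜 q) (hy : y ∈ 𝒜)
    (hpy : p * y = y) (hyq : y * q = y) (hy0 : y ≠ 0) :
    ∃ v ∈ 𝒜, vᵀ * v = q ∧ v * vᵀ = p := by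
  obtain ⟨c, hc, hyy⟩ := hq.exists_pos_smul hy hyq hy0
  have hv : (((√c)⁻¹ • y)ᵀ * ((√c)⁻¹ • y)) = q := by
    rw [Matrix.transpose_smul, smul_mul_smul_comm, hyy, smul_smul, ← mul_inv,
      Real.mul_self_sqrt hc.le, inv_mul_cancel₀ hc.ne', one_smul]
  set v := (√c)⁻¹ • y with hvdef
  have hv𝒜 : v ∈ 𝒜 := SMulMemClass.smul_mem _ hy
  have hpv : p * v = v := by rw [hvdef, mul_smul_comm, hpy]
  have hvq : v * q = v := by rw [hvdef, smul_mul_assoc, hyq]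
  have hvp : vᵀ * p = vᵀ := by
    conv_lhs => rw [← hp.transpose, ← Matrix.transpose_mul, hpv]
  refine ⟨v, hv𝒜, hv, ?_⟩
  obtain ⟨d, hd⟩ := hp.exists_smul (mul_mem hv𝒜 (transpose_mem hv𝒜)) (by simp)
    (by rw [mul_assoc, hvp])
  -- Here v = v vᵀ v = d v, which forces d = 1.
  have h1 : v = d • v := by
    conv_lhs => rw [← hvq, ← hv, ← mul_assoc, hd, smul_mul_assoc, hpv]
  have hv0 : v ≠ 0 := by
    intro h0
    rw [h0, mul_zero] at hv
    exact hq.ne_zero hv.symm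
  have hd1 : d = 1 := by
    have : (d - 1) • v = 0 := by rw [sub_smul, one_smul, ← h1, sub_self]
    rcases smul_eq_zero.1 this with h | h
    · linarith
    · exact absurd h hv0
  rw [hd, hd1, one_smul]

end MinimalProjections

/-! ### Frobenius' theorem for the corner of a minimal projection -/

section Frobenius

variable {ι : Type*} [Fintype ι] [DecidableEq ι]

/-- The restrictions of scalars of the basis `1` of `ℝ`, `1, -i` of `ℂ`, `1, j, i, -k` of `ℍ`.
In these bases, `restrictC z` and `restrictH z` are the matrices of left multiplication by `z`. -/
def BaseField.unit : (𝕂 : BaseField) → Fin 𝕂.dim → Matrix (Fin 𝕂.dim) (Fin 𝕂.dim) ℝ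
  | real => fun _ => 1
  | complex => ![restrictC 1, restrictC (-Complex.I)]
  | quaternion =>
      ![restrictH 1, restrictH ⟨0, 0, 1, 0⟩, restrictH ⟨0, 1, 0, 0⟩, restrictH ⟨0, 0, 0, -1⟩]

/-- A basis of the division algebra `p 𝒜 p` that identifies it with `𝕂`. -/
structure IsDivBasis (𝒜 : StarSubalgebra ℝ (Matrix ι ι ℝ)) (p : Matrix ι ι ℝ) (𝕂 : BaseField)
    (u : Fin 𝕂.dim → Matrix ι ι ℝ) : Prop where
  mem : ∀ s, u s ∈ 𝒜
  mul_proj : ∀ s, u s * p = u s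
  proj_mul : ∀ s, p * u s = u s
  span : ∀ x ∈ 𝒜, p * x = x → x * p = x → ∃ c : Fin 𝕂.dim → ℝ, x = ∑ s, c s • u s
  mul : ∀ s s', u s * u s' = ∑ t, 𝕂.unit s t s' • u t
  transpose_mul : ∀ s s', (u s)ᵀ * u s' = ∑ t, 𝕂.unit s s' t • u t
  transpose_mul_self : ∀ s, (u s)ᵀ * u s = p
  transpose_mul_skew : ∀ s s', s ≠ s' → (u s)ᵀ * u s' = -((u s')ᵀ * u s)

theorem isDivBasis_real {𝒜 : StarSubalgebra ℝ (Matrix ι ι ℝ)} {p : Matrix ι ι ℝ}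
    (hp : IsMinProj 𝒜 p) (h : ∀ x ∈ 𝒜, p * x = x → x * p = x → ∃ a : ℝ, x = a • p) :
    IsDivBasis 𝒜 p .real fun _ => p := by
  have hpp := hp.mul_self
  have hpt := hp.transpose
  have hsub : ∀ s s' : Fin BaseField.real.dim, s = s' :=
    (Subsingleton.elim : ∀ s s' : Fin 1, s = s')
  refine ⟨fun _ => hp.mem, fun _ => hpp, fun _ => hpp, fun x hx h1 h2 => ?_, fun s s' => ?_,
    fun s s' => ?_, fun _ => by rw [hpt, hpp], fun s s' hs => (hs (hsub _ _)).elim⟩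
  · obtain ⟨a, ha⟩ := h x hx h1 h2
    refine ⟨fun _ => a, ?_⟩
    change x = ∑ _ : Fin 1, a • p
    simpa using ha
  · rw [hpp, hsub s' s, hsub s (0 : Fin 1)]
    change p = ∑ t : Fin 1, (1 : Matrix (Fin 1) (Fin 1) ℝ) t 0 • p
    simp
  · rw [hpt, hpp, hsub s' s, hsub s (0 : Fin 1)]
    change p = ∑ t : Fin 1, (1 : Matrix (Fin 1) (Fin 1) ℝ) 0 t • p
    simp

theorem isDivBasis_complex {𝒜 : StarSubalgebra ℝ (Matrix ι ι ℝ)} {p I : Matrix ι ι ℝ}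
    (hp : IsMinProj 𝒜 p) (hI : I ∈ 𝒜) (hpI : p * I = I) (hIp : I * p = I) (hIt : Iᵀ = -I)
    (hII : I * I = -p)
    (h : ∀ x ∈ 𝒜, p * x = x → x * p = x → ∃ a b : ℝ, x = a • p + b • I) :
    IsDivBasis 𝒜 p .complex ![p, -I] := by
  have hpp := hp.mul_self
  have hpt := hp.transpose
  refine ⟨?_, ?_, ?_, fun x hx h1 h2 => ?_, ?_, ?_, ?_, ?_⟩
  · change ∀ s : Fin 2, _
    simp [Fin.forall_fin_two, hp.mem, hI]
  · change ∀ s : Fin 2, _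
    simp [Fin.forall_fin_two, hpp, hIp]
  · change ∀ s : Fin 2, _
    simp [Fin.forall_fin_two, hpp, hpI]
  · obtain ⟨a, b, rfl⟩ := h x hx h1 h2
    refine ⟨![a, -b], ?_⟩
    change _ = ∑ s : Fin 2, _
    simp
  · change ∀ s s' : Fin 2, _ = ∑ t : Fin 2, _
    simp [Fin.forall_fin_two, BaseField.unit, restrictC, hpp, hpI, hIp, hII]
  · change ∀ s s' : Fin 2, _ = ∑ t : Fin 2, _
    simp [Fin.forall_fin_two, BaseField.unit, restrictC, hpp, hpI, hIp, hII, hpt, hIt]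
  · change ∀ s : Fin 2, _
    simp [Fin.forall_fin_two, hpp, hII, hpt, hIt]
  · change ∀ s s' : Fin 2, s ≠ s' → _
    simp [Fin.forall_fin_two, hpI, hIp, hpt, hIt]

/-- The order and the sign match the basis 1, j, i, -k of `BaseField.unit`. The whole multiplication
table follows from the relations between I and J. -/
theorem isDivBasis_quaternion {𝒜 : StarSubalgebra ℝ (Matrix ι ι ℝ)} {p I J : Matrix ι ι ℝ}
    (hp : IsMinProj 𝒜 p) (hI : I ∈ 𝒜) (hpI : p * I = I) (hIp : I * p = I) (hIt : Iᵀ = -I)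
    (hII : I * I = -p) (hJ : J ∈ 𝒜) (hpJ : p * J = J) (hJp : J * p = J) (hJt : Jᵀ = -J)
    (hJJ : J * J = -p) (hJI : J * I = -(I * J))
    (h : ∀ x ∈ 𝒜, p * x = x → x * p = x →
      ∃ a b c d : ℝ, x = a • p + b • I + c • J + d • (I * J)) :
    IsDivBasis 𝒜 p .quaternion ![p, J, I, -(I * J)] := by
  have hpp := hp.mul_self
  have hpt := hp.transpose
  obtain ⟨K, hK⟩ : ∃ K, K = I * J := ⟨_, rfl⟩
  rw [← hK] at hJI
  have hKm : K ∈ 𝒜 := hK ▸ mul_mem hI hJ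
  have hpK : p * K = K := by rw [hK, ← mul_assoc, hpI]
  have hKp : K * p = K := by rw [hK, mul_assoc, hJp]
  have hKt : Kᵀ = -K := by rw [hK, Matrix.transpose_mul, hIt, hJt, neg_mul_neg, hJI, hK]
  have hIK : I * K = -J := by rw [hK, ← mul_assoc, hII, neg_mul, hpJ]
  have hKJ : K * J = -I := by rw [hK, mul_assoc, hJJ, mul_neg, hIp]
  have hKI : K * I = J := by rw [hK, mul_assoc, hJI, mul_neg, hIK, neg_neg]
  have hJK : J * K = I := by
    rw [hK, ← mul_assoc, hJI, neg_mul, hKJ, neg_neg]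
  have hKK : K * K = -p := by
    conv_lhs => enter [1]; rw [hK]
    rw [mul_assoc, hJK, hII]
  have hIJ : I * J = K := hK.symm
  rw [hIJ]
  refine ⟨?_, ?_, ?_, fun x hx h1 h2 => ?_, ?_, ?_, ?_, ?_⟩
  · change ∀ s : Fin 4, _
    simp [Fin.forall_fin_succ, hp.mem, hI, hJ, hKm]
  · change ∀ s : Fin 4, _
    simp [Fin.forall_fin_succ, hpp, hIp, hJp, hKp]
  · change ∀ s : Fin 4, _
    simp [Fin.forall_fin_succ, hpp, hpI, hpJ, hpK]
  · obtain ⟨a, b, c, d, rfl⟩ := h x hx h1 h2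
    refine ⟨![a, c, b, -d], ?_⟩
    change _ = ∑ s : Fin 4, _
    simp [Fin.sum_univ_four, hIJ]
    abel
  · change ∀ s s' : Fin 4, _ = ∑ t : Fin 4, _
    intro s s'
    fin_cases s <;> fin_cases s' <;>
      simp [Fin.sum_univ_four, BaseField.unit, restrictH, hpp, hpI, hIp, hII, hpJ, hJp, hJJ, hpK,
        hKp, hKK, hIJ, hJI, hIK, hKI, hJK, hKJ]
  · change ∀ s s' : Fin 4, _ = ∑ t : Fin 4, _
    intro s s'
    fin_cases s <;> fin_cases s' <;>
      simp [Fin.sum_univ_four, BaseField.unit, restrictH, hpp, hpI, hIp, hII, hpJ, hJp, hJJ, hpK,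
        hKp, hKK, hIJ, hJI, hIK, hKI, hJK, hKJ, hpt, hIt, hJt, hKt]
  · change ∀ s : Fin 4, _
    simp [Fin.forall_fin_succ, hpp, hII, hJJ, hKK, hpt, hIt, hJt, hKt]
  · change ∀ s s' : Fin 4, s ≠ s' → _
    intro s s'
    fin_cases s <;> fin_cases s' <;>
      simp [hpI, hIp, hpJ, hJp, hpK,
        hKp, hIJ, hJI, hIK, hKI, hJK, hKJ, hpt, hIt, hJt, hKt]

/-- A skew element of `p 𝒜 p`. -/
structure IsSkewIn (𝒜 : StarSubalgebra ℝ (Matrix ι ι ℝ)) (p y : Matrix ι ι ℝ) : Prop where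
  mem : y ∈ 𝒜
  proj_mul : p * y = y
  mul_proj : y * p = y
  transpose : yᵀ = -y

variable {𝒜 : StarSubalgebra ℝ (Matrix ι ι ℝ)} {p : Matrix ι ι ℝ}

theorem IsSkewIn.smul {y : Matrix ι ι ℝ} (hy : IsSkewIn 𝒜 p y) (c : ℝ) : IsSkewIn 𝒜 p (c • y) :=
  ⟨SMulMemClass.smul_mem _ hy.mem, by rw [mul_smul_comm, hy.proj_mul],
    by rw [smul_mul_assoc, hy.mul_proj], by rw [Matrix.transpose_smul, hy.transpose, smul_neg]⟩

theorem IsSkewIn.add {y z : Matrix ι ι ℝ} (hy : IsSkewIn 𝒜 p y) (hz : IsSkewIn 𝒜 p z) :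
    IsSkewIn 𝒜 p (y + z) :=
  ⟨add_mem hy.mem hz.mem, by rw [mul_add, hy.proj_mul, hz.proj_mul],
    by rw [add_mul, hy.mul_proj, hz.mul_proj],
    by rw [Matrix.transpose_add, hy.transpose, hz.transpose, neg_add]⟩

theorem IsSkewIn.exists_unit {y : Matrix ι ι ℝ} (hp : IsMinProj 𝒜 p) (hy : IsSkewIn 𝒜 p y)
    (hy0 : y ≠ 0) : ∃ c : ℝ, c ≠ 0 ∧ (c • y) * (c • y) = -p := by
  obtain ⟨c, hc, h⟩ := hp.exists_pos_smul hy.mem hy.mul_proj hy0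
  rw [hy.transpose, neg_mul, neg_eq_iff_eq_neg] at h
  refine ⟨(√c)⁻¹, by positivity, ?_⟩
  rw [smul_mul_smul_comm, h, smul_neg, smul_smul, ← mul_inv, Real.mul_self_sqrt hc.le,
    inv_mul_cancel₀ hc.ne', one_smul]

/-- A skew element can be made to anticommute with a given unit skew element. -/
theorem IsSkewIn.exists_anticommute {y I : Matrix ι ι ℝ} (hp : IsMinProj 𝒜 p)
    (hy : IsSkewIn 𝒜 p y) (hI : IsSkewIn 𝒜 p I) (hII : I * I = -p) :
    ∃ c : ℝ, (y + c • I) * I = -(I * (y + c • I)) := by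
  -- The anticommutator of two skew elements is symmetric, hence a scalar c. Adding (c/2) I changes
  -- it by c I² = -c p.
  obtain ⟨c, hc⟩ := hp.exists_smul (a := y * I + I * y)
    (add_mem (mul_mem hy.mem hI.mem) (mul_mem hI.mem hy.mem))
    (by simp [hy.transpose, hI.transpose, add_comm])
    (by rw [add_mul, mul_assoc, mul_assoc, hI.mul_proj, hy.mul_proj])
  refine ⟨c / 2, ?_⟩
  rw [← add_eq_zero_iff_eq_neg, add_mul, mul_add, smul_mul_assoc, mul_smul_comm, hII,
    add_add_add_comm, hc, ← add_smul, add_halves, smul_neg, add_neg_cancel]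

/-- By minimality the symmetric part of x is a multiple of p; y is the skew part. -/
theorem IsMinProj.exists_skew {x : Matrix ι ι ℝ} (hp : IsMinProj 𝒜 p) (hx : x ∈ 𝒜)
    (h1 : p * x = x) (h2 : x * p = x) : ∃ (a : ℝ) (y : Matrix ι ι ℝ), IsSkewIn 𝒜 p y ∧
      x = a • p + y := by
  have h1' : xᵀ * p = xᵀ := by
    conv_lhs => rw [← hp.transpose, ← Matrix.transpose_mul, h1]
  have h2' : p * xᵀ = xᵀ := by
    conv_lhs => rw [← hp.transpose, ← Matrix.transpose_mul, h2]
  obtain ⟨c, hc⟩ := hp.exists_smul (a := x + xᵀ) (add_mem hx (transpose_mem hx))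
    (by simp [add_comm]) (by rw [add_mul, h2, h1'])
  refine ⟨c / 2, (1 / 2 : ℝ) • (x - xᵀ), ⟨?_, ?_, ?_, ?_⟩, ?_⟩
  · exact SMulMemClass.smul_mem _ (sub_mem hx (transpose_mem hx))
  · rw [mul_smul_comm, mul_sub, h1, h2']
  · rw [smul_mul_assoc, sub_mul, h2, h1']
  · rw [Matrix.transpose_smul, Matrix.transpose_sub, Matrix.transpose_transpose, ← smul_neg,
      neg_sub]
  · rw [div_eq_inv_mul, ← smul_smul, ← hc]
    module

/-- Frobenius' argument: a non-scalar element gives a skew unit I; an element outside the span of p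
and I gives a skew unit J anticommuting with I. After p, I, J and K = IJ nothing is left: a skew
remainder anticommuting with I and J commutes with IJ, so if it also anticommutes with K it is 0. -/
theorem IsMinProj.exists_isDivBasis (hp : IsMinProj 𝒜 p) :
    ∃ (𝕂 : BaseField) (u : Fin 𝕂.dim → Matrix ι ι ℝ), IsDivBasis 𝒜 p 𝕂 u := by
  by_cases hR : ∀ x ∈ 𝒜, p * x = x → x * p = x → ∃ a : ℝ, x = a • p
  · exact ⟨_, _, isDivBasis_real hp hR⟩
  obtain ⟨I, hI, hII⟩ : ∃ I, IsSkewIn 𝒜 p I ∧ I * I = -p := by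
    push Not at hR
    obtain ⟨x, hx, h1, h2, hxa⟩ := hR
    obtain ⟨a, y, hy, rfl⟩ := hp.exists_skew hx h1 h2
    obtain ⟨c, -, hc⟩ := hy.exists_unit hp (fun h => hxa a (by rw [h, add_zero]))
    exact ⟨_, hy.smul c, hc⟩
  by_cases hC : ∀ x ∈ 𝒜, p * x = x → x * p = x → ∃ a b : ℝ, x = a • p + b • I
  · exact ⟨_, _, isDivBasis_complex hp hI.mem hI.proj_mul hI.mul_proj hI.transpose hII hC⟩
  obtain ⟨J, hJ, hJJ, hJI⟩ : ∃ J, IsSkewIn 𝒜 p J ∧ J * J = -p ∧ J * I = -(I * J) := by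
    push Not at hC
    obtain ⟨x, hx, h1, h2, hxa⟩ := hC
    obtain ⟨a, y, hy, rfl⟩ := hp.exists_skew hx h1 h2
    obtain ⟨b, hb⟩ := hy.exists_anticommute hp hI hII
    have hy' := hy.add (hI.smul b)
    obtain ⟨c, -, hc⟩ := hy'.exists_unit hp (fun h => hxa a (-b) (by
      rw [neg_smul, eq_neg_of_add_eq_zero_left h]))
    exact ⟨_, hy'.smul c, hc, by rw [smul_mul_assoc, hb, mul_smul_comm, smul_neg]⟩
  refine ⟨_, _, isDivBasis_quaternion hp hI.mem hI.proj_mul hI.mul_proj hI.transpose hII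
    hJ.mem hJ.proj_mul hJ.mul_proj hJ.transpose hJJ hJI fun x hx h1 h2 => ?_⟩
  obtain ⟨K, hK⟩ : ∃ K, K = I * J := ⟨_, rfl⟩
  rw [← hK] at hJI ⊢
  have hKs : IsSkewIn 𝒜 p K := by
    refine ⟨hK ▸ mul_mem hI.mem hJ.mem, by rw [hK, ← mul_assoc, hI.proj_mul],
      by rw [hK, mul_assoc, hJ.mul_proj], ?_⟩
    rw [hK, Matrix.transpose_mul, hI.transpose, hJ.transpose, neg_mul_neg, hJI, hK]
  have hKI : K * I = -(I * K) := by
    rw [hK, mul_assoc, hJI, mul_neg, hK]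
  have hKJ : K * J = -(J * K) := by
    conv_rhs => rw [hK, ← mul_assoc, hJI, neg_mul, neg_neg]
  have hKK : K * K = -p := by
    conv_lhs => enter [1]; rw [hK]
    rw [mul_assoc, ← neg_neg (J * K), ← hKJ, hK, mul_assoc, hJJ, mul_neg, mul_neg,
      hI.mul_proj, mul_neg, neg_neg, hII]
  obtain ⟨a, y, hy, rfl⟩ := hp.exists_skew hx h1 h2
  obtain ⟨b, hb⟩ := hy.exists_anticommute hp hI hII
  obtain ⟨c, hc⟩ := hy.exists_anticommute hp hJ hJJ
  obtain ⟨d, hd⟩ := hy.exists_anticommute hp hKs hKK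
  have hJI' : I * J = -(J * I) := by rw [hJI, neg_neg, hK]
  have hIK' : I * K = -(K * I) := by rw [hKI, neg_neg]
  have hJK' : J * K = -(K * J) := by rw [hKJ, neg_neg]
  -- As I, J, K anticommute pairwise, correcting y along one of them does not affect its
  -- anticommutators with the other two.
  obtain ⟨z, hz⟩ : ∃ z, z = y + b • I + c • J + d • K := ⟨_, rfl⟩
  have hzI : z * I = -(I * z) := by
    rw [hz, add_mul, add_mul, mul_add, mul_add, hb, smul_mul_assoc, smul_mul_assoc, mul_smul_comm,
      mul_smul_comm, hKI, hJI, hK]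
    module
  have hzJ : z * J = -(J * z) := by
    rw [hz, add_right_comm y, add_mul, add_mul, mul_add, mul_add, hc, smul_mul_assoc,
      smul_mul_assoc, mul_smul_comm, mul_smul_comm, hKJ, hJI']
    module
  have hzK : z * K = -(K * z) := by
    rw [hz, add_right_comm, add_right_comm y, add_right_comm, add_mul, add_mul, mul_add, mul_add,
      hd, smul_mul_assoc, smul_mul_assoc, mul_smul_comm, mul_smul_comm, hIK', hJK']
    module
  have hzK' : z * K = K * z := by
    rw [hK, ← mul_assoc, hzI, neg_mul, mul_assoc, hzJ, mul_neg, neg_neg, mul_assoc]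
  have hzK0 : z * K = 0 := by
    have h2 : z * K = -(z * K) := by
      conv_lhs => rw [hzK, ← hzK']
    ext i j
    have := congrFun (congrFun h2 i) j
    rw [Matrix.neg_apply] at this
    exact self_eq_neg.1 this
  have hzp : z * p = z := by
    rw [hz]
    exact (((hy.add (hI.smul b)).add (hJ.smul c)).add (hKs.smul d)).mul_proj
  have hz0 : z = 0 := by
    rw [← hzp, ← neg_neg p, ← hKK, mul_neg, ← mul_assoc, hzK0, zero_mul, neg_zero]
  refine ⟨a, -b, -c, -d, ?_⟩
  have hy2 : y = z - b • I - c • J - d • K := by rw [hz]; abel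
  rw [hy2, hz0]
  module

end Frobenius

/-! ### Orthonormal bases over the division algebra -/

section AdaptedVectors

open Matrix

variable {ι : Type*} [Fintype ι] [DecidableEq ι]

/-- A family of vectors that is orthonormal for the standard scalar product. -/
def IsOrthonormal {κ : Type*} [DecidableEq κ] (b : κ → ι → ℝ) : Prop :=
  ∀ i j, b i ⬝ᵥ b j = if i = j then 1 else 0

/-- The sum of the rank one matrices defined by the members of a family of vectors. -/
def outerSum {κ : Type*} [Fintype κ] (b : κ → ι → ℝ) : Matrix ι ι ℝ := ∑ i, vecMulVec (b i) (b i)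

theorem transpose_outerSum {κ : Type*} [Fintype κ] (b : κ → ι → ℝ) :
    (outerSum b)ᵀ = outerSum b := by
  simp [outerSum, transpose_sum, transpose_vecMulVec]

theorem IsOrthonormal.outerSum_mulVec {κ : Type*} [Fintype κ] [DecidableEq κ] {b : κ → ι → ℝ}
    (hb : IsOrthonormal b) (j : κ) : outerSum b *ᵥ b j = b j := by
  simp [outerSum, sum_mulVec, vecMulVec_mulVec, hb _ j]

theorem mul_outerSum {κ : Type*} [Fintype κ] (b : κ → ι → ℝ) (A : Matrix ι ι ℝ) :
    A * outerSum b = ∑ i, vecMulVec (A *ᵥ b i) (b i) := by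
  simp [outerSum, Finset.mul_sum, mul_vecMulVec]

theorem outerSum_mul {κ : Type*} [Fintype κ] (b : κ → ι → ℝ) (A : Matrix ι ι ℝ) :
    outerSum b * A = ∑ i, vecMulVec (b i) (Aᵀ *ᵥ b i) := by
  simp [outerSum, Finset.sum_mul, vecMulVec_mul, mulVec_transpose]

theorem IsOrthonormal.isStarProjection {κ : Type*} [Fintype κ] [DecidableEq κ] {b : κ → ι → ℝ}
    (hb : IsOrthonormal b) : IsStarProjection (outerSum b) := by
  refine isStarProjection_iff_transpose.2 ⟨?_, transpose_outerSum b⟩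
  rw [mul_outerSum]
  simp_rw [hb.outerSum_mulVec]
  rfl

theorem mulVec_dotProduct_mulVec (A B : Matrix ι ι ℝ) (v w : ι → ℝ) :
    (A *ᵥ v) ⬝ᵥ (B *ᵥ w) = v ⬝ᵥ ((Aᵀ * B) *ᵥ w) := by
  rw [← mulVec_mulVec, dotProduct_mulVec v, vecMul_transpose]

theorem BaseField.dim_pos (𝕂 : BaseField) : 0 < 𝕂.dim := by
  cases 𝕂 <;> simp [BaseField.dim]

theorem exists_unit_vector {Q : Matrix ι ι ℝ} (hQ : Q * Q = Q) (hQ0 : Q ≠ 0) :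
    ∃ w : ι → ℝ, Q *ᵥ w = w ∧ w ⬝ᵥ w = 1 := by
  obtain ⟨v, hv⟩ : ∃ v, Q *ᵥ v ≠ 0 := by
    by_contra! h
    exact hQ0 (toLin'.injective (LinearMap.ext fun v => by simpa using h v))
  have hpos : 0 < (Q *ᵥ v) ⬝ᵥ (Q *ᵥ v) := by
    refine lt_of_le_of_ne (Finset.sum_nonneg fun i _ => mul_self_nonneg _) fun h => hv ?_
    exact dotProduct_self_eq_zero.1 h.symm
  refine ⟨(√((Q *ᵥ v) ⬝ᵥ (Q *ᵥ v)))⁻¹ • (Q *ᵥ v), by rw [mulVec_smul, mulVec_mulVec, hQ], ?_⟩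
  rw [smul_dotProduct, dotProduct_smul, smul_smul, ← mul_inv, Real.mul_self_sqrt hpos.le,
    smul_eq_mul, inv_mul_cancel₀ hpos.ne']

variable {𝒜 : StarSubalgebra ℝ (Matrix ι ι ℝ)} {p : Matrix ι ι ℝ} {𝕂 : BaseField}
  {u : Fin 𝕂.dim → Matrix ι ι ℝ}

/-- For s ≠ s' the product of the transpose of u s with u s' is skew, so its quadratic form vanishes
at w. -/
theorem IsDivBasis.isOrthonormal (hu : IsDivBasis 𝒜 p 𝕂 u) {w : ι → ℝ} (hpw : p *ᵥ w = w)
    (hw : w ⬝ᵥ w = 1) : IsOrthonormal fun s => u s *ᵥ w := by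
  intro s s'
  rw [mulVec_dotProduct_mulVec]
  split_ifs with h
  · rw [h, hu.transpose_mul_self, hpw, hw]
  · have h1 : w ⬝ᵥ ((u s)ᵀ * u s') *ᵥ w = w ⬝ᵥ ((u s')ᵀ * u s) *ᵥ w := by
      rw [← mulVec_dotProduct_mulVec, dotProduct_comm, mulVec_dotProduct_mulVec]
    rw [hu.transpose_mul_skew s s' h, neg_mulVec, dotProduct_neg] at h1 ⊢
    linarith

/-- The structure constants in `mul` and `transpose_mul` are transposes of each other, so both sides
are the same double sum. In effect, the 𝕂-line through w is stable under the u r and their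
transposes. -/
theorem IsDivBasis.commute_outerSum (hu : IsDivBasis 𝒜 p 𝕂 u) (w : ι → ℝ) (r : Fin 𝕂.dim) :
    u r * outerSum (fun s => u s *ᵥ w) = outerSum (fun s => u s *ᵥ w) * u r := by
  rw [mul_outerSum, outerSum_mul]
  simp_rw [mulVec_mulVec, hu.mul, hu.transpose_mul, sum_mulVec, smul_mulVec]
  have h1 : ∀ (c : Fin 𝕂.dim → ℝ) (f : Fin 𝕂.dim → ι → ℝ) (v : ι → ℝ),
      vecMulVec (∑ t, c t • f t) v = ∑ t, c t • vecMulVec (f t) v := by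
    intro c f v
    ext i j
    simp [vecMulVec_apply, Matrix.sum_apply, Finset.sum_mul, mul_assoc]
  have h2 : ∀ (c : Fin 𝕂.dim → ℝ) (f : Fin 𝕂.dim → ι → ℝ) (v : ι → ℝ),
      vecMulVec v (∑ t, c t • f t) = ∑ t, c t • vecMulVec v (f t) := by
    intro c f v
    ext i j
    simp [vecMulVec_apply, Matrix.sum_apply, Finset.mul_sum, mul_left_comm]
  simp_rw [h1, h2]
  rw [Finset.sum_comm]

/-- Gram–Schmidt over 𝕂: split off the 𝕂-line of a unit vector in the range of Q. The complementary
projection still commutes with all u s and has smaller rank. -/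
theorem IsDivBasis.exists_vectors_of_commute (hu : IsDivBasis 𝒜 p 𝕂 u)
    (Q : Matrix ι ι ℝ) (hQ : IsStarProjection Q) (hpQ : p * Q = Q)
    (hQu : ∀ s, u s * Q = Q * u s) :
    ∃ (τ : Type) (_ : Fintype τ) (_ : DecidableEq τ) (w : τ → ι → ℝ),
      IsOrthonormal (fun x : Fin 𝕂.dim × τ => u x.1 *ᵥ w x.2) ∧
      outerSum (fun x : Fin 𝕂.dim × τ => u x.1 *ᵥ w x.2) = Q := by
  induction hr : Q.rank using Nat.strong_induction_on generalizing Q with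
  | _ r ih =>
  subst hr
  by_cases h0 : Q = 0
  · refine ⟨Empty, inferInstance, inferInstance, Empty.elim, fun i => i.2.elim, ?_⟩
    simp [outerSum, h0]
  obtain ⟨w, hQw, hw⟩ := exists_unit_vector hQ.isIdempotentElem h0
  have hpw : p *ᵥ w = w := by rw [← hQw, mulVec_mulVec, hpQ]
  have ho := hu.isOrthonormal hpw hw
  set Q₁ := outerSum (fun s => u s *ᵥ w) with hQ₁
  have hQQ₁ : Q * Q₁ = Q₁ := by
    rw [hQ₁, mul_outerSum]
    simp_rw [mulVec_mulVec, ← hQu, ← mulVec_mulVec, hQw]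
    rfl
  have hQ₁Q : Q₁ * Q = Q₁ := IsStarProjection.comm_of_mul_eq' hQ ho.isStarProjection hQQ₁
  have hp₁ := ho.isStarProjection.isIdempotentElem
  have hQ₁0 : Q₁ ≠ 0 := by
    intro h
    have h1 := ho.outerSum_mulVec ⟨0, 𝕂.dim_pos⟩
    have h2 := ho ⟨0, 𝕂.dim_pos⟩ ⟨0, 𝕂.dim_pos⟩
    rw [← hQ₁, h, zero_mulVec] at h1
    simp [← h1] at h2
  have hp' : IsStarProjection (Q - Q₁) := ho.isStarProjection.sub_of_mul_eq_left hQ hQ₁Q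
  obtain ⟨τ, _, _, v, hv, hvs⟩ := ih (Q - Q₁).rank
    (rank_lt_of_mul_eq hp'.isIdempotentElem
      (by rw [mul_sub, hQQ₁, hQ.isIdempotentElem]) (by rw [sub_mul, hQ₁Q, hQ.isIdempotentElem])
      (by simpa using hQ₁0)) (Q - Q₁) hp'
    (by rw [mul_sub, hpQ, ← hQQ₁, ← mul_assoc, hpQ])
    (fun s => by rw [mul_sub, sub_mul, hQu, hQ₁, hu.commute_outerSum]) rfl
  have hcross : ∀ (s : Fin 𝕂.dim) (x : Fin 𝕂.dim × τ), (u s *ᵥ w) ⬝ᵥ (u x.1 *ᵥ v x.2) = 0 := by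
    intro s x
    rw [← ho.outerSum_mulVec s, ← hv.outerSum_mulVec x, hvs, mulVec_dotProduct_mulVec,
      transpose_outerSum, ← hQ₁, mul_sub, hQ₁Q, hp₁, sub_self, zero_mulVec, dotProduct_zero]
  refine ⟨Option τ, inferInstance, inferInstance, fun t => t.elim w v, ?_, ?_⟩
  · rintro ⟨s, _ | t⟩ ⟨s', _ | t'⟩
    · simpa using ho s s'
    · simpa using hcross s (s', t')
    · rw [dotProduct_comm]
      simpa using hcross s' (s, t)
    · simpa using hv (s, t) (s', t')
  · rw [outerSum, Fintype.sum_prod_type]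
    simp_rw [Fintype.sum_option]
    rw [Finset.sum_add_distrib]
    have : Q = Q₁ + (Q - Q₁) := by abel
    rw [this, ← hvs, outerSum, Fintype.sum_prod_type]
    rfl

theorem IsDivBasis.exists_vectors (hu : IsDivBasis 𝒜 p 𝕂 u) (hp : IsMinProj 𝒜 p) :
    ∃ (k : ℕ) (w : Fin k → ι → ℝ), 0 < k ∧
      IsOrthonormal (fun x : Fin 𝕂.dim × Fin k => u x.1 *ᵥ w x.2) ∧
      outerSum (fun x : Fin 𝕂.dim × Fin k => u x.1 *ᵥ w x.2) = p := by
  obtain ⟨τ, _, _, w, hw, hws⟩ := hu.exists_vectors_of_commute p hp.proj hp.mul_self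
    fun s => by rw [hu.mul_proj, hu.proj_mul]
  let e := Fintype.equivFin τ
  have hsum : outerSum (fun x : Fin 𝕂.dim × Fin (Fintype.card τ) =>
      u x.1 *ᵥ w (e.symm x.2)) = p := by
    rw [← hws, outerSum, outerSum]
    exact Fintype.sum_equiv ((Equiv.refl _).prodCongr e.symm) _ _ fun x => rfl
  refine ⟨_, fun t => w (e.symm t), ?_, ?_, hsum⟩
  · rw [Fintype.card_pos_iff]
    by_contra h
    rw [not_nonempty_iff] at h
    refine hp.ne_zero ?_
    rw [← hws]
    simp [outerSum]
  · rintro ⟨s, t⟩ ⟨s', t'⟩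
    simpa using hw (s, e.symm t) (s', e.symm t')

end AdaptedVectors

/-! ### Restriction of scalars and the matrices of a factor -/

section Isometries

open Matrix

/-- Replacing the entries of a matrix over `R` by their images in a real matrix algebra. -/
def blowUp {R : Type*} [Ring R] {d m : ℕ} (φ : R →+* Matrix (Fin d) (Fin d) ℝ)
    (a : Matrix (Fin m) (Fin m) R) : Matrix (Fin d × Fin m) (Fin d × Fin m) ℝ :=
  Matrix.of fun p q => φ (a p.2 q.2) p.1 q.1

section BlowUp

variable {R : Type*} [Ring R] {d m : ℕ} (φ : R →+* Matrix (Fin d) (Fin d) ℝ)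

theorem blowUp_mul (a b : Matrix (Fin m) (Fin m) R) :
    blowUp φ (a * b) = blowUp φ a * blowUp φ b := by
  ext p q
  simp only [blowUp, of_apply, Matrix.mul_apply, map_sum, map_mul, Matrix.sum_apply,
    Fintype.sum_prod_type]
  rw [Finset.sum_comm]

theorem blowUp_one : blowUp φ (1 : Matrix (Fin m) (Fin m) R) = 1 := by
  ext ⟨s, i⟩ ⟨s', j⟩
  by_cases h : i = j <;> by_cases h' : s = s' <;> simp [blowUp, Matrix.one_apply, h, h']

theorem blowUp_injective (hφ : Function.Injective φ) :
    Function.Injective (blowUp φ : Matrix (Fin m) (Fin m) R → _) := by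
  intro a b hab
  ext i j
  refine hφ (Matrix.ext fun s s' => ?_)
  exact congrFun (congrFun hab (s, i)) (s', j)

theorem blowUp_star [StarRing R] (hstar : ∀ r, φ (star r) = (φ r)ᵀ)
    (a : Matrix (Fin m) (Fin m) R) : blowUp φ (star a) = (blowUp φ a)ᵀ := by
  ext p q
  simp [blowUp, star_apply, hstar]

/-- Both unitarity equations transfer along the injective *-homomorphism; for square real matrices
either one implies the other. -/
theorem mem_unitary_iff_blowUp [StarRing R] (hφ : Function.Injective φ)
    (hstar : ∀ r, φ (star r) = (φ r)ᵀ) (a : Matrix (Fin m) (Fin m) R) :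
    a ∈ unitary (Matrix (Fin m) (Fin m) R) ↔ blowUp φ a * (blowUp φ a)ᵀ = 1 := by
  have h1 : star a * a = 1 ↔ (blowUp φ a)ᵀ * blowUp φ a = 1 := by
    rw [← (blowUp_injective φ hφ).eq_iff, blowUp_mul, blowUp_star φ hstar, blowUp_one]
  have h2 : a * star a = 1 ↔ blowUp φ a * (blowUp φ a)ᵀ = 1 := by
    rw [← (blowUp_injective φ hφ).eq_iff, blowUp_mul, blowUp_star φ hstar, blowUp_one]
  rw [Unitary.mem_iff, h1, h2, mul_eq_one_comm, and_self]

end BlowUp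

/-- `restrictC` as a ring homomorphism. -/
def restrictCHom : ℂ →+* Matrix (Fin 2) (Fin 2) ℝ where
  toFun := restrictC
  map_one' := by ext i j; fin_cases i <;> fin_cases j <;> simp [restrictC]
  map_zero' := by ext i j; fin_cases i <;> fin_cases j <;> simp [restrictC]
  map_mul' a b := by
    ext i j; (fin_cases i <;> fin_cases j <;> simp [restrictC]) <;> ring
  map_add' a b := by
    ext i j; (fin_cases i <;> fin_cases j <;> simp [restrictC]); ring

/-- `restrictH` as a ring homomorphism. -/
def restrictHHom : ℍ[ℝ] →+* Matrix (Fin 4) (Fin 4) ℝ where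
  toFun := restrictH
  map_one' := by ext i j; fin_cases i <;> fin_cases j <;> simp [restrictH]
  map_zero' := by ext i j; fin_cases i <;> fin_cases j <;> simp [restrictH]
  map_mul' a b := by
    ext i j
    fin_cases i <;> fin_cases j <;>
      simp [restrictH, Matrix.mul_apply, Fin.sum_univ_four] <;> ring
  map_add' a b := by
    ext i j; fin_cases i <;> fin_cases j <;> simp [restrictH] <;> ring

/-- A description uniform in 𝕂, in terms of real coefficients of the basis units, so that later
arguments need not distinguish the three fields. -/
theorem mem_isometries_iff {m : ℕ} (𝕂 : BaseField)
    (A : Matrix (Fin 𝕂.dim × Fin m) (Fin 𝕂.dim × Fin m) ℝ) :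
    A ∈ 𝕂.isometries m ↔ A * Aᵀ = 1 ∧ ∃ c : Fin m → Fin m → Fin 𝕂.dim → ℝ,
      ∀ s i s' j, A (s, i) (s', j) = ∑ l, c i j l * 𝕂.unit l s s' := by
  cases 𝕂 with
  | real =>
    let φ : ℝ →+* Matrix (Fin 1) (Fin 1) ℝ := Matrix.scalar (Fin 1)
    have hφ : ∀ r s s', φ r s s' = r := fun r s s' => by
      simp [φ, Subsingleton.elim s s']
    have hinj : Function.Injective φ := RingHom.injective _
    have hstar : ∀ r, φ (star r) = (φ r)ᵀ := fun r => by simp [φ]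
    have hof : ∀ a : Matrix (Fin m) (Fin m) ℝ,
        (Matrix.of fun p q => a p.2 q.2 : Matrix (Fin 1 × Fin m) (Fin 1 × Fin m) ℝ) =
          blowUp φ a := fun a => by
      ext p q
      simp [blowUp, hφ]
    constructor
    · rintro ⟨a, ha, hA⟩
      have hA : A = blowUp φ a := hA.trans (hof a)
      refine ⟨hA ▸ (mem_unitary_iff_blowUp φ hinj hstar a).1 ha, fun i j _ => a i j, ?_⟩
      change ∀ (s : Fin 1) i (s' : Fin 1) j, _ = ∑ l : Fin 1, a i j * (1 : Matrix _ _ ℝ) s s'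
      intro s i s' j
      rw [hA, Subsingleton.elim s s', Fin.sum_univ_one, one_apply_eq, mul_one]
      exact hφ _ _ _
    · rintro ⟨hA, c, hc⟩
      have : A = blowUp φ (Matrix.of fun i j => c i j (0 : Fin 1)) := by
        ext ⟨s, i⟩ ⟨s', j⟩
        rw [hc]
        change Fin 1 at s s'
        change ∑ l : Fin 1, c i j l * (1 : Matrix (Fin 1) (Fin 1) ℝ) s s' =
          φ (c i j (0 : Fin 1)) s s'
        rw [Subsingleton.elim s s', Fin.sum_univ_one, one_apply_eq, mul_one, hφ]
      rw [this] at hA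
      exact ⟨_, (mem_unitary_iff_blowUp φ hinj hstar _).2 hA, this.trans (hof _).symm⟩
  | complex =>
    have hinj : Function.Injective restrictCHom := RingHom.injective _
    have hstar : ∀ r, restrictCHom (star r) = (restrictCHom r)ᵀ := fun r => by
      ext i j; fin_cases i <;> fin_cases j <;> simp [restrictCHom, restrictC]
    constructor
    · rintro ⟨a, ha, rfl⟩
      refine ⟨(mem_unitary_iff_blowUp _ hinj hstar a).1 ha,
        fun i j => ![(a i j).re, -(a i j).im], ?_⟩
      change ∀ (s : Fin 2) i (s' : Fin 2) j, _ = ∑ l : Fin 2, _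
      intro s i s' j
      fin_cases s <;> fin_cases s' <;> simp [BaseField.unit, restrictC]
    · rintro ⟨hA, c, hc⟩
      have : A = blowUp restrictCHom
          -- The second basis unit is -i, whence the sign.
          (Matrix.of fun i j => ⟨c i j (0 : Fin 2), -c i j (1 : Fin 2)⟩) := by
        ext ⟨s, i⟩ ⟨s', j⟩
        rw [hc]
        change Fin 2 at s s'
        change ∑ l : Fin 2, _ = restrictC ⟨c i j (0 : Fin 2), -c i j (1 : Fin 2)⟩ s s'
        fin_cases s <;> fin_cases s' <;> simp [BaseField.unit, restrictC]
      rw [this] at hA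
      exact ⟨_, (mem_unitary_iff_blowUp _ hinj hstar _).2 hA, this⟩
  | quaternion =>
    have hinj : Function.Injective restrictHHom := RingHom.injective _
    have hstar : ∀ r, restrictHHom (star r) = (restrictHHom r)ᵀ := fun r => by
      ext i j; fin_cases i <;> fin_cases j <;> simp [restrictHHom, restrictH]
    constructor
    · rintro ⟨a, ha, rfl⟩
      refine ⟨(mem_unitary_iff_blowUp _ hinj hstar a).1 ha,
        fun i j => ![(a i j).re, (a i j).imJ, (a i j).imI, -(a i j).imK], ?_⟩
      change ∀ (s : Fin 4) i (s' : Fin 4) j, _ = ∑ l : Fin 4, _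
      intro s i s' j
      fin_cases s <;> fin_cases s' <;> simp [BaseField.unit, restrictH, Fin.sum_univ_four]
    · rintro ⟨hA, c, hc⟩
      have : A = blowUp restrictHHom
          -- The basis is 1, j, i, -k: coefficients 1 and 2 trade places and the last changes sign.
          (Matrix.of fun i j => ⟨c i j (0 : Fin 4), c i j (2 : Fin 4), c i j (1 : Fin 4),
            -c i j (3 : Fin 4)⟩) := by
        ext ⟨s, i⟩ ⟨s', j⟩
        rw [hc]
        change Fin 4 at s s'
        change ∑ l : Fin 4, _ = restrictH ⟨c i j (0 : Fin 4), c i j (2 : Fin 4),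
          c i j (1 : Fin 4), -c i j (3 : Fin 4)⟩ s s'
        fin_cases s <;> fin_cases s' <;> simp [BaseField.unit, restrictH, Fin.sum_univ_four]
      rw [this] at hA
      exact ⟨_, (mem_unitary_iff_blowUp _ hinj hstar _).2 hA, this⟩

/-- The matrices of a factor are the orthogonal matrices of the form `(φ(d i j))ᵢⱼ ⊗ 1`. -/
theorem Factor.mem_matrices_iff (F : Factor) (A : Matrix F.Index F.Index ℝ) :
    A ∈ F.matrices ↔ A * Aᵀ = 1 ∧ ∃ c : Fin F.rank → Fin F.rank → Fin F.base.dim → ℝ,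
      ∀ s i t s' j t', A ((s, i), t) ((s', j), t') =
        if t = t' then ∑ l, c i j l * F.base.unit l s s' else 0 := by
  constructor
  · rintro ⟨a, ha, rfl⟩
    obtain ⟨h1, c, hc⟩ := (mem_isometries_iff _ _).1 ha
    refine ⟨?_, c, fun s i t s' j t' => ?_⟩
    · rw [← kroneckerMap_transpose, transpose_one, ← mul_kronecker_mul, h1, one_mul,
        one_kronecker_one]
    · rw [kroneckerMap_apply, hc, one_apply, mul_ite, mul_one, mul_zero]
  · rintro ⟨hA, c, hc⟩
    let a : Matrix (Fin F.base.dim × Fin F.rank) (Fin F.base.dim × Fin F.rank) ℝ :=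
      Matrix.of fun p q => ∑ l, c p.2 q.2 l * F.base.unit l p.1 q.1
    have hAa : A = a ⊗ₖ (1 : Matrix (Fin F.mult) (Fin F.mult) ℝ) := by
      ext ⟨⟨s, i⟩, t⟩ ⟨⟨s', j⟩, t'⟩
      rw [hc, kroneckerMap_apply, one_apply, mul_ite, mul_one, mul_zero]
      rfl
    refine ⟨a, (mem_isometries_iff _ _).2 ⟨?_, c, fun s i s' j => rfl⟩, hAa⟩
    rw [hAa, ← kroneckerMap_transpose, transpose_one, ← mul_kronecker_mul, one_mul] at hA
    ext p q
    have := congrFun (congrFun hA (p, ⟨0, F.mult_pos⟩)) (q, ⟨0, F.mult_pos⟩)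
    rw [kroneckerMap_apply, one_apply_eq, mul_one] at this
    rw [this, one_apply, one_apply]
    simp

end Isometries

/-! ### Structure theorem: a Howe subgroup has factors -/

section Assembly

open Matrix

variable {n : ℕ} {𝒜 : StarSubalgebra ℝ (Matrix (Fin n) (Fin n) ℝ)}

theorem _root_.IsStarProjection.mul_eq_left {p v : Matrix (Fin n) (Fin n) ℝ}
    (hp : IsStarProjection p) (h : vᵀ * v = p) : v * p = v := by
  obtain ⟨h1, h2⟩ := isStarProjection_iff_transpose.1 hp
  have h3 : (v * p - v)ᴴ * (v * p - v) = 0 := by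
    rw [conjTranspose_eq_transpose_of_trivial, transpose_sub, transpose_mul, h2, sub_mul, mul_sub,
      mul_sub, mul_assoc, mul_assoc, ← mul_assoc vᵀ v, h, h1, h1, sub_self]
  exact sub_eq_zero.1 (conjTranspose_mul_self_eq_zero.1 h3)

theorem _root_.IsStarProjection.mul_eq_right {p v : Matrix (Fin n) (Fin n) ℝ}
    (hp : IsStarProjection p) (h : v * vᵀ = p) : p * v = v := by
  have := congrArg transpose (hp.mul_eq_left (v := vᵀ) (by rwa [transpose_transpose]))
  rwa [transpose_mul, transpose_transpose, (isStarProjection_iff_transpose.1 hp).2] at this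

/-- The minimal projections of a decomposition of `1`, sorted by equivalence, and partial
isometries identifying equivalent ones with a representative. -/
theorem exists_sorted_partial_isometries (𝒜 : StarSubalgebra ℝ (Matrix (Fin n) (Fin n) ℝ)) :
    ∃ (r : ℕ) (p : Fin r → Matrix (Fin n) (Fin n) ℝ) (m : Fin r → ℕ)
      (v : ∀ q, Fin (m q) → Matrix (Fin n) (Fin n) ℝ),
      (∀ q, IsMinProj 𝒜 (p q)) ∧ (∀ q, 0 < m q) ∧ (∀ q a, v q a ∈ 𝒜) ∧
      (∀ q a, (v q a)ᵀ * v q a = p q) ∧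
      (∀ q a a', a ≠ a' → (v q a)ᵀ * v q a' = 0) ∧
      (∀ q q', q ≠ q' → ∀ x ∈ 𝒜, p q * x * p q' = 0) ∧
      ∑ q, ∑ a, v q a * (v q a)ᵀ = 1 := by
  classical
  obtain ⟨κ, _, f, hf, horth, hsum⟩ :=
    exists_isMinProj_sum 𝒜 1 (one_mem _) (IsStarProjection.one _)
  have hmulv : ∀ i v, v * vᵀ = f i → f i * v = v := fun i v hv => (hf i).proj.mul_eq_right hv
  -- Murray–von Neumann equivalence; its classes will be the factors, and their sizes the ranks.
  let R : κ → κ → Prop := fun i j => ∃ v ∈ 𝒜, vᵀ * v = f j ∧ v * vᵀ = f i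
  have hR : Equivalence R := by
    refine ⟨fun i => ⟨f i, (hf i).mem, ?_, ?_⟩, ?_, ?_⟩
    · rw [(hf i).transpose, (hf i).mul_self]
    · rw [(hf i).transpose, (hf i).mul_self]
    · rintro i j ⟨v, hv, h1, h2⟩
      exact ⟨vᵀ, transpose_mem hv, by rwa [transpose_transpose], by rwa [transpose_transpose]⟩
    · rintro i j k ⟨v, hv, h1, h2⟩ ⟨w, hw, h3, h4⟩
      refine ⟨v * w, mul_mem hv hw, ?_, ?_⟩
      · rw [transpose_mul, mul_assoc, ← mul_assoc _ v, h1, hmulv j w h4, h3]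
      · rw [transpose_mul, mul_assoc, ← mul_assoc w, h4, ← mul_assoc,
          (hf j).proj.mul_eq_left h1, h2]
  let st : Setoid κ := ⟨R, hR⟩
  let eQ : Quotient st ≃ Fin (Fintype.card (Quotient st)) := Fintype.equivFin _
  let cl : κ → Fin (Fintype.card (Quotient st)) := fun i => eQ ⟦i⟧
  let rep : Fin (Fintype.card (Quotient st)) → κ := fun q => (eQ.symm q).out
  have hrep : ∀ i, R i (rep (cl i)) := by
    intro i
    have h : (⟦i⟧ : Quotient st) = ⟦(eQ.symm (eQ ⟦i⟧)).out⟧ := by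
      rw [Quotient.out_eq, Equiv.symm_apply_apply]
    exact Quotient.exact h
  have hclrep : ∀ q, cl (rep q) = q := fun q => by
    change eQ ⟦(eQ.symm q).out⟧ = q
    rw [Quotient.out_eq, Equiv.apply_symm_apply]
  choose v hv hv1 hv2 using hrep
  let eF : ∀ q, {i // cl i = q} ≃ Fin (Fintype.card {i // cl i = q}) := fun q =>
    Fintype.equivFin _
  refine ⟨_, fun q => f (rep q), fun q => Fintype.card {i // cl i = q},
    fun q a => v ((eF q).symm a).1, fun q => hf _, fun q => ?_, fun q a => hv _, fun q a => ?_,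
    fun q a a' ha => ?_, fun q q' hq x hx => ?_, ?_⟩
  · exact Fintype.card_pos_iff.2 ⟨⟨rep q, hclrep q⟩⟩
  · dsimp only
    rw [hv1, ((eF q).symm a).2]
  · have hne : ((eF q).symm a).1 ≠ ((eF q).symm a').1 := fun h =>
      ha ((eF q).symm.injective (Subtype.ext h))
    dsimp only
    rw [← hmulv _ _ (hv2 ((eF q).symm a).1), ← hmulv _ _ (hv2 ((eF q).symm a').1), transpose_mul,
      (hf _).transpose, mul_assoc, ← mul_assoc (f _) (f _), horth _ _ hne, zero_mul, mul_zero]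
  -- A nonzero corner would yield a partial isometry between representatives of different classes.
  · by_contra hne
    obtain ⟨y, hy, h1, h2⟩ := (hf (rep q)).exists_partial_isometry (hf (rep q'))
      (mul_mem (mul_mem (hf (rep q)).mem hx) (hf (rep q')).mem)
      (by rw [← mul_assoc, ← mul_assoc, (hf _).mul_self]) (by rw [mul_assoc, (hf _).mul_self]) hne
    refine hq ?_
    rw [← hclrep q, ← hclrep q']
    exact congrArg eQ (Quotient.sound ⟨y, hy, h1, h2⟩)
  · simp only [hv2]
    rw [← hsum, ← (Equiv.sigmaFiberEquiv cl).sum_comp, Fintype.sum_sigma]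
    exact Finset.sum_congr rfl fun q _ => (eF q).symm.sum_comp fun i => f i.1

/-- In the orthonormal basis u s w t, left multiplication by d = ∑ c l u l has the matrix φ(d) ⊗ 1:
it acts on the index s by the structure constants and leaves t alone. -/
theorem IsDivBasis.coefficient {p : Matrix (Fin n) (Fin n) ℝ} {𝕂 : BaseField}
    {u : Fin 𝕂.dim → Matrix (Fin n) (Fin n) ℝ} (hu : IsDivBasis 𝒜 p 𝕂 u) {k : ℕ}
    {w : Fin k → Fin n → ℝ} (hw : IsOrthonormal fun x : Fin 𝕂.dim × Fin k => u x.1 *ᵥ w x.2)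
    (c : Fin 𝕂.dim → ℝ) (s s' : Fin 𝕂.dim) (t t' : Fin k) :
    (u s *ᵥ w t) ⬝ᵥ ((∑ l, c l • u l) *ᵥ (u s' *ᵥ w t')) =
      if t = t' then ∑ l, c l * 𝕂.unit l s s' else 0 := by
  have h : ∀ r, (u s *ᵥ w t) ⬝ᵥ (u r *ᵥ w t') = if s = r ∧ t = t' then 1 else 0 := fun r => by
    simpa using hw (s, t) (r, t')
  simp only [mulVec_mulVec, Finset.sum_mul, smul_mul_assoc, hu.mul, sum_mulVec, smul_mulVec,
    dotProduct_sum, dotProduct_smul, h, smul_eq_mul]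
  by_cases ht : t = t' <;> simp [ht]

/-- The vectors v u w form an orthonormal basis of ℝⁿ. In it an element x of 𝒜 is block diagonal,
with entries given by the corners vᵀ x v' in p 𝒜 p ≅ 𝕂; conversely, arbitrary corners can be
reassembled into an element of 𝒜. -/
theorem hasFactors_of_splitting {H : Subgroup (O n)}
    (hH : ∀ x : O n, x ∈ H ↔ (x : Matrix (Fin n) (Fin n) ℝ) ∈ 𝒜)
    {r : ℕ} (F : Fin r → Factor) (p : Fin r → Matrix (Fin n) (Fin n) ℝ)
    (u : ∀ q, Fin (F q).base.dim → Matrix (Fin n) (Fin n) ℝ)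
    (w : ∀ q, Fin (F q).mult → Fin n → ℝ)
    (v : ∀ q, Fin (F q).rank → Matrix (Fin n) (Fin n) ℝ)
    (hp : ∀ q, IsMinProj 𝒜 (p q))
    (hu : ∀ q, IsDivBasis 𝒜 (p q) (F q).base (u q))
    (hw : ∀ q, IsOrthonormal
      fun x : Fin (F q).base.dim × Fin (F q).mult => u q x.1 *ᵥ w q x.2)
    (hws : ∀ q, outerSum
      (fun x : Fin (F q).base.dim × Fin (F q).mult => u q x.1 *ᵥ w q x.2) = p q)
    (hv : ∀ q a, v q a ∈ 𝒜) (hvv : ∀ q a, (v q a)ᵀ * v q a = p q)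
    (hvo : ∀ q a a', a ≠ a' → (v q a)ᵀ * v q a' = 0)
    (hpp : ∀ q q', q ≠ q' → ∀ x ∈ 𝒜, p q * x * p q' = 0)
    (hvs : ∑ q, ∑ a, v q a * (v q a)ᵀ = 1) : HasFactors H F := by
  classical
  have hvp : ∀ q a, v q a * p q = v q a := fun q a => (hp q).proj.mul_eq_left (hvv q a)
  have hpv : ∀ q a, p q * (v q a)ᵀ = (v q a)ᵀ := fun q a => by
    simpa [(hp q).transpose] using congrArg transpose (hvp q a)
  have hvxv : ∀ q q' a a' x, x ∈ 𝒜 → q ≠ q' → (v q a)ᵀ * x * v q' a' = 0 := by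
    intro q q' a a' x hx hq
    have h := hpp q q' hq _ (mul_mem (mul_mem (transpose_mem (hv q a)) hx) (hv q' a'))
    rwa [← mul_assoc, ← mul_assoc, hpv, mul_assoc, hvp] at h
  let B : Matrix (Fin n) (Σ q, (F q).Index) ℝ :=
    Matrix.of fun i α => (v α.1 α.2.1.2 *ᵥ (u α.1 α.2.1.1 *ᵥ w α.1 α.2.2)) i
  have hBcoef : ∀ X α β, (Bᵀ * X * B) α β =
      (u α.1 α.2.1.1 *ᵥ w α.1 α.2.2) ⬝ᵥ (((v α.1 α.2.1.2)ᵀ * X * v β.1 β.2.1.2) *ᵥ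
        (u β.1 β.2.1.1 *ᵥ w β.1 β.2.2)) := by
    intro X α β
    rw [Matrix.mul_assoc, Matrix.mul_assoc (v α.1 α.2.1.2)ᵀ, ← mulVec_dotProduct_mulVec,
      ← mulVec_mulVec]
    rfl
  let D : (∀ q, Fin (F q).rank → Fin (F q).rank → Fin (F q).base.dim → ℝ) →
      ∀ q, Matrix (F q).Index (F q).Index ℝ := fun c q => Matrix.of fun x y =>
        if x.2 = y.2 then ∑ l, c q x.1.2 y.1.2 l * (F q).base.unit l x.1.1 y.1.1 else 0
  have hBD : ∀ X ∈ 𝒜, ∀ c : ∀ q, Fin (F q).rank → Fin (F q).rank → Fin (F q).base.dim → ℝ,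
      (∀ q a a', (v q a)ᵀ * X * v q a' = ∑ l, c q a a' l • u q l) →
      Bᵀ * X * B = blockDiagonal' (D c) := by
    intro X hX c hc
    ext ⟨q, ⟨s, a⟩, t⟩ ⟨q', ⟨s', a'⟩, t'⟩
    rw [hBcoef]
    by_cases hq : q = q'
    · subst hq
      rw [blockDiagonal'_apply_eq, hc, (hu q).coefficient (hw q)]
      rfl
    · rw [blockDiagonal'_apply_ne _ _ _ hq, hvxv _ _ _ _ _ hX hq, zero_mulVec, dotProduct_zero]
  -- Completeness of the basis: v vᵀ = v p vᵀ with p the sum of the rank one projections, and the v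
  -- vᵀ add up to 1.
  have hBB : B * Bᵀ = 1 := by
    have hvw : ∀ q a, v q a * (v q a)ᵀ = ∑ x : Fin (F q).base.dim × Fin (F q).mult,
        vecMulVec (v q a *ᵥ (u q x.1 *ᵥ w q x.2)) (v q a *ᵥ (u q x.1 *ᵥ w q x.2)) := by
      intro q a
      calc v q a * (v q a)ᵀ = v q a * outerSum _ * (v q a)ᵀ := by rw [hws, hvp]
        _ = _ := by
          rw [mul_outerSum, Finset.sum_mul]
          simp_rw [vecMulVec_mul, vecMul_transpose]
    rw [← hvs]
    ext i j
    simp only [Matrix.mul_apply, transpose_apply, Fintype.sum_sigma, Fintype.sum_prod_type,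
      Matrix.sum_apply, hvw, vecMulVec_apply]
    refine Finset.sum_congr rfl fun q _ => ?_
    rw [Finset.sum_comm]
    rfl
  have hBB' : Bᵀ * B = 1 := by
    rw [← Matrix.mul_one Bᵀ]
    ext ⟨q, ⟨s, a⟩, t⟩ ⟨q', ⟨s', a'⟩, t'⟩
    rw [hBcoef]
    by_cases hq : q = q'
    · subst hq
      dsimp only
      rw [Matrix.mul_one]
      by_cases ha : a = a'
      · subst ha
        rw [hvv, mulVec_mulVec, (hu q).proj_mul]
        refine (hw q (s, t) (s', t')).trans ?_
        simp [one_apply]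
      · rw [hvo q a a' ha, zero_mulVec, dotProduct_zero, one_apply_ne]
        simp [ha]
    · rw [hvxv _ _ _ _ _ (one_mem _) hq, zero_mulVec, dotProduct_zero, one_apply_ne]
      simp [hq]
  -- B is square because B Bᵀ and Bᵀ B are both identities and have the same trace.
  have hcard : Fintype.card (Σ q, (F q).Index) = Fintype.card (Fin n) := by
    have h := trace_mul_comm B Bᵀ
    rw [hBB, hBB', trace_one, trace_one] at h
    exact_mod_cast h.symm
  let e : (Σ q, (F q).Index) ≃ Fin n := Fintype.equivOfCardEq hcard
  let g : O n := ⟨B.submatrix id e.symm, by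
    rw [mem_orthogonalGroup_iff, transpose_submatrix, submatrix_mul_equiv, hBB]
    simp⟩
  have hg : ∀ x : O n, ((g⁻¹ * x * g : O n) : Matrix (Fin n) (Fin n) ℝ) =
      Matrix.reindex e e (Bᵀ * x.1 * B) := by
    intro x
    change (B.submatrix id e.symm)ᵀ * (x : Matrix (Fin n) (Fin n) ℝ) * B.submatrix id e.symm = _
    rw [reindex_apply]
    rfl
  refine ⟨e, g, fun x => ?_⟩
  simp_rw [hg, (Matrix.reindex e e).injective.eq_iff]
  rw [hH]
  constructor
  · intro hx
    have hcoef : ∀ q a a', ∃ c : Fin (F q).base.dim → ℝ,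
        (v q a)ᵀ * x.1 * v q a' = ∑ l, c l • u q l := fun q a a' =>
      (hu q).span _ (mul_mem (mul_mem (transpose_mem (hv q a)) hx) (hv q a'))
        (by rw [← mul_assoc, ← mul_assoc, hpv]) (by rw [mul_assoc, hvp])
    choose c hc using hcoef
    have hD := hBD x.1 hx c hc
    refine ⟨D c, fun q => (Factor.mem_matrices_iff _ _).2
      ⟨?_, c q, fun s i t s' j t' => rfl⟩, hD⟩
    have h1 : blockDiagonal' (D c) * (blockDiagonal' (D c))ᵀ = 1 := by
      have hxx := (mem_orthogonalGroup_iff (Fin n) ℝ).1 x.2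
      rw [← hD]
      calc _ = Bᵀ * (x.1 * (B * Bᵀ) * x.1ᵀ) * B := by
            simp only [transpose_mul, transpose_transpose, Matrix.mul_assoc]
        _ = 1 := by rw [hBB, Matrix.mul_one, hxx, Matrix.mul_one, hBB']
    rw [blockDiagonal'_transpose, ← blockDiagonal'_mul, ← blockDiagonal'_one] at h1
    exact congrFun (blockDiagonal'_injective h1) q
  · rintro ⟨A, hA, hAx⟩
    choose hA1 c hc using fun q => (Factor.mem_matrices_iff _ _).1 (hA q)
    have hAD : A = D c := by
      funext q
      ext ⟨⟨s, i⟩, t⟩ ⟨⟨s', j⟩, t'⟩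
      exact hc q s i t s' j t'
    -- The element of 𝒜 with the prescribed corners; it has the same matrix as x in the basis B, so
    -- it equals x.
    let X : Matrix (Fin n) (Fin n) ℝ :=
      ∑ q, ∑ a, ∑ a', v q a * (∑ l, c q a a' l • u q l) * (v q a')ᵀ
    have hX : X ∈ 𝒜 := sum_mem fun q _ => sum_mem fun a _ => sum_mem fun a' _ =>
      mul_mem (mul_mem (hv q a) (sum_mem fun l _ => SMulMemClass.smul_mem _ ((hu q).mem l)))
        (transpose_mem (hv q a'))
    have hcX : ∀ q a a', (v q a)ᵀ * X * v q a' = ∑ l, c q a a' l • u q l := by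
      intro q a a'
      have hvv0 : ∀ q' b, q' ≠ q → (v q a)ᵀ * v q' b = 0 := fun q' b hq => by
        simpa using hvxv q q' a b 1 (one_mem _) hq.symm
      have hd : p q * (∑ l, c q a a' l • u q l) * p q = ∑ l, c q a a' l • u q l := by
        simp_rw [Finset.mul_sum, Finset.sum_mul, mul_smul_comm, smul_mul_assoc, (hu q).proj_mul,
          (hu q).mul_proj]
      simp only [X]
      obtain ⟨d, hdef⟩ : ∃ d : ∀ q, Fin (F q).rank → Fin (F q).rank → Matrix (Fin n) (Fin n) ℝ,
          ∀ q a a', ∑ l, c q a a' l • u q l = d q a a' := ⟨_, fun _ _ _ => rfl⟩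
      simp only [hdef] at hd ⊢
      have hassoc : ∀ x y d z t : Matrix (Fin n) (Fin n) ℝ,
          x * (y * d * z) * t = (x * y) * d * (z * t) := fun x y d z t => by
        simp only [mul_assoc]
      simp_rw [Finset.mul_sum, Finset.sum_mul, hassoc]
      rw [Finset.sum_eq_single q, Finset.sum_eq_single a, Finset.sum_eq_single a', hvv, hvv, hd]
      · intro b _ hb
        rw [hvo q b a' hb, mul_zero]
      · simp
      · intro b _ hb
        simp [hvo q a b hb.symm]
      · simp
      · intro q' _ hq
        simp [hvv0 q' _ hq]
      · simp
    have hXx : Bᵀ * X * B = Bᵀ * x.1 * B := by rw [hBD X hX c hcX, hAx, hAD]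
    have : X = x.1 := by
      calc X = (B * Bᵀ) * X * (B * Bᵀ) := by rw [hBB, Matrix.one_mul, Matrix.mul_one]
        _ = B * (Bᵀ * X * B) * Bᵀ := by simp only [Matrix.mul_assoc]
        _ = (B * Bᵀ) * x.1 * (B * Bᵀ) := by rw [hXx]; simp only [Matrix.mul_assoc]
        _ = x.1 := by rw [hBB, Matrix.one_mul, Matrix.mul_one]
    exact this ▸ hX

theorem exists_hasFactors {H : Subgroup (O n)}
    (hH : ∀ x : O n, x ∈ H ↔ (x : Matrix (Fin n) (Fin n) ℝ) ∈ 𝒜) :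
    ∃ (r : ℕ) (F : Fin r → Factor), HasFactors H F := by
  obtain ⟨r, p, m, v, hp, hm, hv, hvv, hvo, hpp, hvs⟩ := exists_sorted_partial_isometries 𝒜
  choose 𝕂 u hu using fun q => (hp q).exists_isDivBasis
  choose k w hk hw hws using fun q => (hu q).exists_vectors (hp q)
  exact ⟨r, fun q => ⟨𝕂 q, m q, k q, hm q, hk q⟩,
    hasFactors_of_splitting hH _ p u w v hp hu hw hws hv hvv hvo hpp hvs⟩

/-- As H = `C (C H)`, it consists of the orthogonal matrices in the commutant of `C H`. Since `C H`
is closed under inverses, which are transposes, this commutant is also the *-centralizer. -/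
theorem IsHowe.exists_hasFactors {H : Subgroup (O n)} (hH : IsHowe H) :
    ∃ (r : ℕ) (F : Fin r → Factor), HasFactors H F := by
  let T : Set (Matrix (Fin n) (Fin n) ℝ) :=
    (fun g : O n => (g : Matrix (Fin n) (Fin n) ℝ)) '' (C H : Set (O n))
  refine Howe.exists_hasFactors (𝒜 := StarSubalgebra.centralizer ℝ T) fun x => ?_
  rw [StarSubalgebra.mem_centralizer_iff]
  conv_lhs => rw [← hH.C_C, mem_C]
  constructor
  · rintro h _ ⟨g, hg, rfl⟩
    exact ⟨congrArg Subtype.val (h g hg), congrArg Subtype.val (h g⁻¹ (inv_mem hg))⟩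
  · intro h g hg
    exact Subtype.ext (h _ ⟨g, hg, rfl⟩).1

end Assembly

/-! ### Determinants on the factors -/

section Determinants

open Matrix

/-- J turns the real space into a complex one on which A is complex linear; the real determinant is
the squared modulus of the complex determinant. -/
theorem _root_.Matrix.det_nonneg_of_commute_complex_structure {ι : Type*} [Fintype ι]
    [DecidableEq ι] {A J : Matrix ι ι ℝ} (hJ : J * J = -1) (hAJ : A * J = J * A) : 0 ≤ A.det := by
  let f : ℂ →ₐ[ℝ] Module.End ℝ (ι → ℝ) := Complex.lift ⟨toLin' J, by
    rw [Module.End.mul_eq_comp, ← toLin'_mul, hJ, map_neg, toLin'_one]; rfl⟩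
  have hf : ∀ (z : ℂ) (v : ι → ℝ), f z v = z.re • v + z.im • (J *ᵥ v) := fun z v => by
    simp [f, Complex.liftAux_apply, Module.algebraMap_end_apply]
  let : Module ℂ (ι → ℝ) := Module.compHom (ι → ℝ) f.toRingHom
  have hsmul : ∀ (z : ℂ) (v : ι → ℝ), z • v = z.re • v + z.im • (J *ᵥ v) := hf
  have : IsScalarTower ℝ ℂ (ι → ℝ) := ⟨fun r z v => by
    rw [hsmul, hsmul, smul_add, smul_smul, smul_smul]; simp⟩
  let A' : (ι → ℝ) →ₗ[ℂ] (ι → ℝ) :=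
    { toFun := fun v => A *ᵥ v
      map_add' := fun v w => mulVec_add A v w
      map_smul' := fun z v => by
        simp only [RingHom.id_apply, hsmul, mulVec_add, mulVec_smul, mulVec_mulVec, hAJ] }
  have h : LinearMap.det (A'.restrictScalars ℝ) = Algebra.norm ℝ (LinearMap.det A') :=
    LinearMap.det_restrictScalars
  have h' : A'.restrictScalars ℝ = toLin' A := LinearMap.ext fun v => rfl
  rw [h', LinearMap.det_toLin', Algebra.norm_complex_apply] at h
  rw [h]
  exact Complex.normSq_nonneg _

theorem _root_.Matrix.det_blockDiagonal_sigma {r : ℕ} {m : Fin r → Type*} [∀ i, Fintype (m i)]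
    [∀ i, DecidableEq (m i)] (A : ∀ i, Matrix (m i) (m i) ℝ) :
    (blockDiagonal' A).det = ∏ i, (A i).det := by
  rw [(blockTriangular_blockDiagonal' A).det_fintype]
  refine Finset.prod_congr rfl fun i _ => ?_
  rw [← det_submatrix_equiv_self (Equiv.sigmaSubtype i).symm]
  congr 1
  ext a b
  exact blockDiagonal'_apply_eq A i a b

theorem BaseField.unit_zero (𝕂 : BaseField) : 𝕂.unit ⟨0, 𝕂.dim_pos⟩ = 1 := by
  cases 𝕂 with
  | real => rfl
  | complex => exact map_one restrictCHom
  | quaternion => exact map_one restrictHHom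

/-- Right multiplication by an imaginary unit. -/
theorem BaseField.exists_complex_structure {𝕂 : BaseField} (h : 𝕂 ≠ .real) :
    ∃ j : Matrix (Fin 𝕂.dim) (Fin 𝕂.dim) ℝ, j * j = -1 ∧ ∀ l, 𝕂.unit l * j = j * 𝕂.unit l := by
  cases 𝕂 with
  | real => exact absurd rfl h
  | complex =>
    refine ⟨restrictCHom Complex.I, ?_, ?_⟩
    · have h : restrictCHom Complex.I * restrictCHom Complex.I = -1 := by
        rw [← map_mul, Complex.I_mul_I, map_neg, map_one]
      exact h
    · change ∀ l : Fin 2, _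
      rw [Fin.forall_fin_two]
      refine ⟨?_, ?_⟩
      · exact ((Commute.all (1 : ℂ) Complex.I).map restrictCHom).eq
      · exact ((Commute.all (-Complex.I) Complex.I).map restrictCHom).eq
  | quaternion =>
    -- Right multiplication by i in the basis 1, j, i, -k; it commutes with all left
    -- multiplications.
    let j : Matrix (Fin 4) (Fin 4) ℝ := !![0, 0, -1, 0; 0, 0, 0, -1; 1, 0, 0, 0; 0, 1, 0, 0]
    have hjj : j * j = -1 := by
      ext a b
      fin_cases a <;> fin_cases b <;> simp [j, Matrix.mul_apply, Fin.sum_univ_four]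
    have hj : ∀ q, restrictH q * j = j * restrictH q := by
      intro q
      ext a b
      fin_cases a <;> fin_cases b <;> simp [j, restrictH, Matrix.mul_apply, Fin.sum_univ_four]
    refine ⟨j, hjj, ?_⟩
    change ∀ l : Fin 4, _
    intro l
    fin_cases l <;> exact hj _

theorem Factor.det_nonneg_of_ne_real {F : Factor} {A : Matrix F.Index F.Index ℝ}
    (hA : A ∈ F.matrices) (hF : F.base ≠ .real) : 0 ≤ A.det := by
  obtain ⟨-, c, hc⟩ := (F.mem_matrices_iff A).1 hA
  obtain ⟨j, hjj, hj⟩ := BaseField.exists_complex_structure hF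
  have hAc : A = ∑ l, (F.base.unit l ⊗ₖ (Matrix.of fun i i' => c i i' l)) ⊗ₖ
      (1 : Matrix (Fin F.mult) (Fin F.mult) ℝ) := by
    ext ⟨⟨s, i⟩, t⟩ ⟨⟨s', i'⟩, t'⟩
    rw [hc, Matrix.sum_apply]
    by_cases ht : t = t' <;> simp [kroneckerMap_apply, one_apply, ht, mul_comm]
  refine det_nonneg_of_commute_complex_structure (J := (j ⊗ₖ (1 : Matrix (Fin F.rank) _ ℝ)) ⊗ₖ
      (1 : Matrix (Fin F.mult) (Fin F.mult) ℝ)) ?_ ?_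
  · rw [← mul_kronecker_mul, ← mul_kronecker_mul, hjj]
    ext ⟨⟨s, i⟩, t⟩ ⟨⟨s', i'⟩, t'⟩
    by_cases h1 : s = s' <;> by_cases h2 : i = i' <;> by_cases h3 : t = t' <;>
      simp [kroneckerMap_apply, one_apply, h1, h2, h3]
  · rw [hAc, Finset.sum_mul, Finset.mul_sum]
    refine Finset.sum_congr rfl fun l _ => ?_
    simp only [← mul_kronecker_mul, hj, one_mul, mul_one]

theorem Factor.det_nonneg_of_even {F : Factor} {A : Matrix F.Index F.Index ℝ}
    (hA : A ∈ F.matrices) (hF : Even F.mult) : 0 ≤ A.det := by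
  obtain ⟨a, -, rfl⟩ := hA
  rw [det_kronecker, det_one, one_pow, mul_one, Fintype.card_fin]
  exact hF.pow_nonneg _

theorem det_eq_one_or_of_mul_transpose {ι : Type*} [Fintype ι] [DecidableEq ι]
    {A : Matrix ι ι ℝ} (h : A * Aᵀ = 1) : A.det = 1 ∨ A.det = -1 := by
  have h := congrArg Matrix.det h
  rw [Matrix.det_mul, Matrix.det_transpose, Matrix.det_one] at h
  exact mul_self_eq_one_iff.1 h

/-- The determinant is ±1. It is nonnegative, being an even power for a real base field and by the
complex structure otherwise. -/
theorem Factor.det_eq_one {F : Factor} {A : Matrix F.Index F.Index ℝ} (hA : A ∈ F.matrices)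
    (hF : ¬ F.IsOddO) : A.det = 1 := by
  have h0 : 0 ≤ A.det := by
    by_cases hr : F.base = .real
    · exact Factor.det_nonneg_of_even hA (Nat.not_odd_iff_even.1 fun h => hF ⟨hr, h⟩)
    · exact Factor.det_nonneg_of_ne_real hA hr
  rcases det_eq_one_or_of_mul_transpose ((F.mem_matrices_iff A).1 hA).1 with h | h
  · exact h
  · rw [h] at h0
    norm_num at h0

/-- With k odd and det a = ±1, the determinant (det a)^k of a ⊗ 1 is det a. -/
theorem Factor.exists_of_isOddO {F : Factor} (hF : F.IsOddO) {A : Matrix F.Index F.Index ℝ}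
    (hA : A ∈ F.matrices) : ∃ a : Matrix (Fin F.rank) (Fin F.rank) ℝ, a * aᵀ = 1 ∧
      A.det = a.det ∧ ∀ x y, A x y = if x.2 = y.2 then a x.1.2 y.1.2 else 0 := by
  obtain ⟨𝕂, m, k, hm, hk⟩ := F
  obtain ⟨rfl, hodd⟩ := hF
  obtain ⟨b, ⟨a, ha, rfl⟩, rfl⟩ := hA
  have ha1 : a * aᵀ = 1 := (Unitary.mem_iff.1 ha).2
  refine ⟨a, ha1, ?_, fun x y => ?_⟩
  · have hb : (Matrix.of fun p q => a p.2 q.2 : Matrix (Fin 1 × Fin m) (Fin 1 × Fin m) ℝ).det =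
        a.det := by
      rw [← det_submatrix_equiv_self (Equiv.uniqueProd (Fin m) (Fin 1))]
      rfl
    rw [det_kronecker, det_one, one_pow, mul_one, Fintype.card_fin]
    refine (congrArg (· ^ k) hb).trans ?_
    rcases det_eq_one_or_of_mul_transpose ha1 with h | h
    · simp [h]
    · simp [h, Odd.neg_one_pow hodd]
  · rw [kroneckerMap_apply, one_apply, mul_ite, mul_one, mul_zero]
    rfl

end Determinants

/-! ### Reflections and the equation `C (S H) = C H` -/

section Coordinates

open Matrix

variable {n r : ℕ} {H : Subgroup (O n)} {F : Fin r → Factor}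

/-- The isomorphism of orthogonal groups induced by a bijection of the index sets. -/
def orthogonalReindex {κ : Type*} [Fintype κ] [DecidableEq κ] (e : κ ≃ Fin n) :
    O n ≃* orthogonalGroup κ ℝ where
  toFun x := ⟨x.1.submatrix e e, by
    rw [mem_orthogonalGroup_iff, transpose_submatrix, submatrix_mul_equiv,
      (mem_orthogonalGroup_iff _ _).1 x.2, submatrix_one_equiv]⟩
  invFun y := ⟨y.1.submatrix e.symm e.symm, by
    rw [mem_orthogonalGroup_iff, transpose_submatrix, submatrix_mul_equiv,
      (mem_orthogonalGroup_iff _ _).1 y.2, submatrix_one_equiv]⟩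
  left_inv x := by ext; simp
  right_inv y := by ext; simp
  map_mul' x y := Subtype.ext (submatrix_mul_equiv x.1 y.1 e e e).symm

theorem HasFactors.exists_coordinates (h : HasFactors H F) :
    ∃ ψ : O n ≃* orthogonalGroup (Σ i, (F i).Index) ℝ, (∀ x, (ψ x).1.det = x.1.det) ∧
      ∀ x, x ∈ H ↔ ∃ A : (i : Fin r) → Matrix (F i).Index (F i).Index ℝ,
        (∀ i, A i ∈ (F i).matrices) ∧ (ψ x).1 = blockDiagonal' A := by
  obtain ⟨e, g, h⟩ := h
  refine ⟨(MulAut.conj g⁻¹).trans (orthogonalReindex e), fun x => ?_, fun x => ?_⟩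
  · change ((g⁻¹ * x * g⁻¹⁻¹ : O n).1.submatrix e e).det = _
    rw [det_submatrix_equiv_self, inv_inv, Submonoid.coe_mul, Submonoid.coe_mul,
      Matrix.det_mul_right_comm, ← Submonoid.coe_mul, inv_mul_cancel, Submonoid.coe_one, one_mul]
  · rw [h]
    refine exists_congr fun A => and_congr_right fun _ => ?_
    change _ ↔ (g⁻¹ * x * g⁻¹⁻¹ : O n).1.submatrix e e = _
    rw [inv_inv, ← (Matrix.reindex e e).symm_apply_eq]
    rfl

theorem HasFactors.card (h : HasFactors H F) :
    n = ∑ i, (F i).base.dim * (F i).rank * (F i).mult := by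
  obtain ⟨e, -⟩ := h
  simpa using (Fintype.card_congr e).symm

/-- The diagonal entries of the reflection in the subspace belonging to one coordinate of
one of the factors. -/
def reflectionSign (F : Fin r → Factor) (β : Σ i, Fin (F i).rank) (x : Σ i, (F i).Index) : ℝ :=
  if (⟨x.1, x.2.1.2⟩ : Σ i, Fin (F i).rank) = β then -1 else 1

theorem reflectionSign_mul_self (β : Σ i, Fin (F i).rank) (x : Σ i, (F i).Index) :
    reflectionSign F β x * reflectionSign F β x = 1 := by
  unfold reflectionSign
  split_ifs <;> norm_num

theorem diagonal_reflectionSign (β : Σ i, Fin (F i).rank) :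
    diagonal (reflectionSign F β) =
      blockDiagonal' fun i => diagonal fun y => reflectionSign F β ⟨i, y⟩ :=
  (blockDiagonal'_diagonal fun i y => reflectionSign F β ⟨i, y⟩).symm

theorem diagonal_reflectionSign_mem (β : Σ i, Fin (F i).rank) (i : Fin r) :
    (diagonal fun y => reflectionSign F β ⟨i, y⟩) ∈ (F i).matrices := by
  -- The coefficients are the signs at the unit 1, which has index 0, on the diagonal.
  refine (Factor.mem_matrices_iff _ _).2 ⟨?_, fun j j' l => if j = j' then
    (if l = ⟨0, (F i).base.dim_pos⟩ then (if (⟨i, j⟩ : Σ i, Fin (F i).rank) = β then -1 else 1)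
      else 0) else 0, fun s j t s' j' t' => ?_⟩
  · rw [diagonal_transpose, diagonal_mul_diagonal]
    simp_rw [reflectionSign_mul_self]
    exact diagonal_one
  · by_cases ht : t = t' <;> by_cases hj : j = j' <;> by_cases hs : s = s' <;>
      simp [ht, hj, hs, BaseField.unit_zero, reflectionSign, one_apply]

/-- The real dimension of the base field is 1, so the (-1)-eigenspace has the multiplicity as its
dimension, which is odd. -/
theorem det_diagonal_reflectionSign (β : Σ i, Fin (F i).rank) (hβ : (F β.1).IsOddO) :
    (diagonal (reflectionSign F β)).det = -1 := by
  obtain ⟨i, a⟩ := β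
  rw [det_diagonal, Fintype.prod_sigma, Fintype.prod_eq_single i]
  · rw [Fintype.prod_prod_type, Fintype.prod_prod_type_right, Fintype.prod_eq_single a]
    · have hd : (F i).base.dim = 1 := by rw [hβ.1]; rfl
      simp [reflectionSign, hd, hβ.2.neg_one_pow]
    · intro a' ha
      simp [reflectionSign, ha]
  · intro i' hi
    refine Finset.prod_eq_one fun x _ => if_neg fun h => hi (congrArg Sigma.fst h)

theorem reflection_mem_orthogonalGroup (β : Σ i, Fin (F i).rank) :
    diagonal (reflectionSign F β) ∈ orthogonalGroup (Σ i, (F i).Index) ℝ := by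
  rw [mem_orthogonalGroup_iff, diagonal_transpose, diagonal_mul_diagonal]
  simp_rw [reflectionSign_mul_self]
  exact diagonal_one

/-- The reflections that a group with factors contains. -/
theorem exists_reflection {ψ : O n ≃* orthogonalGroup (Σ i, (F i).Index) ℝ}
    (hdet : ∀ x, (ψ x).1.det = x.1.det)
    (hψ : ∀ x, x ∈ H ↔ ∃ A : (i : Fin r) → Matrix (F i).Index (F i).Index ℝ,
        (∀ i, A i ∈ (F i).matrices) ∧ (ψ x).1 = blockDiagonal' A) (β : Σ i, Fin (F i).rank)
    (hβ : (F β.1).IsOddO) :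
    ∃ x ∈ H, x ∉ SO n ∧ (ψ x).1 = diagonal (reflectionSign F β) := by
  refine ⟨ψ.symm ⟨_, reflection_mem_orthogonalGroup β⟩, (hψ _).2 ⟨_, diagonal_reflectionSign_mem β,
    ?_⟩, ?_, ?_⟩
  · exact (congrArg Subtype.val (ψ.apply_symm_apply _)).trans (diagonal_reflectionSign β)
  · rw [mem_SO, ← hdet, MulEquiv.apply_symm_apply, det_diagonal_reflectionSign β hβ]
    norm_num
  · rw [MulEquiv.apply_symm_apply]

/-- Products of two of the reflections ρ₁, ρ₂, ρ₃ lie in `S H`, and ρ₁ρ₂ + ρ₁ρ₃ - ρ₂ρ₃ + 1 = 2ρ₁. So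
whatever centralizes `S H` commutes with ρ₁, and H is generated by `S H` and ρ₁. -/
theorem C_S_of_three (h : HasFactors H F) (β₁ β₂ β₃ : Σ i, Fin (F i).rank) (h12 : β₁ ≠ β₂)
    (h13 : β₁ ≠ β₃) (h23 : β₂ ≠ β₃) (h1 : (F β₁.1).IsOddO) (h2 : (F β₂.1).IsOddO)
    (h3 : (F β₃.1).IsOddO) : C (S H) = C H := by
  refine le_antisymm (fun x hx => ?_) (C_anti (S_le H))
  obtain ⟨ψ, hdet, hψ⟩ := h.exists_coordinates
  obtain ⟨x₁, hH1, hS1, e1⟩ := exists_reflection hdet hψ β₁ h1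
  obtain ⟨x₂, hH2, hS2, e2⟩ := exists_reflection hdet hψ β₂ h2
  obtain ⟨x₃, hH3, hS3, e3⟩ := exists_reflection hdet hψ β₃ h3
  have hcomm : ∀ y z : O n, y ∈ H → z ∈ H → y ∉ SO n → z ∉ SO n →
      Commute ((ψ y).1 * (ψ z).1) (ψ x).1 := by
    intro y z hy hz hy' hz'
    have := mem_C.1 hx (y * z) (mem_S.2 ⟨mul_mem_SO hy' hz', mul_mem hy hz⟩)
    have := congrArg (fun t => (ψ t).1) this
    simp only [map_mul, Submonoid.coe_mul] at this
    exact this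
  have hlin : (ψ x₁).1 * (ψ x₂).1 + (ψ x₁).1 * (ψ x₃).1 - (ψ x₂).1 * (ψ x₃).1 + 1 =
      (2 : ℝ) • (ψ x₁).1 := by
    rw [e1, e2, e3, diagonal_mul_diagonal, diagonal_mul_diagonal, diagonal_mul_diagonal,
      diagonal_add, diagonal_sub, ← diagonal_one, diagonal_add, ← diagonal_smul]
    congr 1
    funext y
    simp only [reflectionSign, Pi.smul_apply, smul_eq_mul]
    generalize (⟨y.1, y.2.1.2⟩ : Σ i, Fin (F i).rank) = γ
    by_cases g1 : γ = β₁
    · simp only [g1, h12, h13, if_true, if_false]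
      norm_num
    by_cases g2 : γ = β₂
    · simp only [g2, h12.symm, h23, if_true, if_false]
      norm_num
    by_cases g3 : γ = β₃
    · simp only [g3, h13.symm, h23.symm, if_true, if_false]
      norm_num
    simp only [g1, g2, g3, if_false]
    norm_num
  have h1 : Commute (ψ x₁).1 (ψ x).1 := by
    have := (((hcomm x₁ x₂ hH1 hH2 hS1 hS2).add_left (hcomm x₁ x₃ hH1 hH3 hS1 hS3)).sub_left
      (hcomm x₂ x₃ hH2 hH3 hS2 hS3)).add_left (Commute.one_left _)
    rw [hlin] at this
    simpa [smul_smul] using this.smul_left (2⁻¹ : ℝ)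
  have h1' : Commute x₁ x := ψ.injective (Subtype.ext (by
    rw [map_mul, map_mul]
    exact h1.eq))
  refine mem_C.2 fun y hy => ?_
  by_cases hys : y ∈ SO n
  · exact mem_C.1 hx y (mem_S.2 ⟨hys, hy⟩)
  · have h4 : Commute (x₁ * y) x := mem_C.1 hx _ (mem_S.2 ⟨mul_mem_SO hS1 hys, mul_mem hH1 hy⟩)
    have h5 := h1'.inv_left.mul_left h4
    rwa [inv_mul_cancel_left] at h5

theorem le_SO_of_no_isOddO (h : HasFactors H F) (hF : ∀ i, ¬ (F i).IsOddO) : H ≤ SO n := by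
  intro x hx
  obtain ⟨ψ, hdet, hψ⟩ := h.exists_coordinates
  obtain ⟨A, hA, hx⟩ := (hψ x).1 hx
  rw [mem_SO, ← hdet, hx, det_blockDiagonal_sigma]
  exact Finset.prod_eq_one fun i _ => Factor.det_eq_one (hA i) (hF i)

theorem Factor.even_of_not_isOddO {F : Factor} (hF : ¬ F.IsOddO) :
    Even (F.base.dim * F.rank * F.mult) := by
  obtain ⟨𝕂, m, k, hm, hk⟩ := F
  cases 𝕂 with
  | real => exact (Nat.not_odd_iff_even.1 fun h => hF ⟨rfl, h⟩).mul_left _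
  | complex => exact (Even.mul_right (by decide : Even 2) m).mul_right k
  | quaternion => exact (Even.mul_right (by decide : Even 4) m).mul_right k

/-- Outside cases (A) and (B), the ranks of the O-factors of odd multiplicity add up to 0, 1 or at
least 3, and evenness of n excludes 1. -/
theorem C_S_of_not_case (hn : Even n) (hH : IsHowe H) (hA : ¬ CaseA H) (hB : ¬ CaseB H) :
    C (S H) = C H := by
  obtain ⟨r, F, hF⟩ := hH.exists_hasFactors
  by_cases hno : ∀ i, ¬ (F i).IsOddO
  · rw [S_of_le (le_SO_of_no_isOddO hF hno)]
  push Not at hno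
  obtain ⟨i, hi⟩ := hno
  have hne : ∀ (q : Fin r) (a b : Fin (F q).rank), a ≠ b →
      (⟨q, a⟩ : Σ i, Fin (F i).rank) ≠ ⟨q, b⟩ := fun q a b hab h =>
    hab (by simpa using h)
  have hne' : ∀ (q q' : Fin r) (a : Fin (F q).rank) (b : Fin (F q').rank), q ≠ q' →
      (⟨q, a⟩ : Σ i, Fin (F i).rank) ≠ ⟨q', b⟩ := fun q q' a b hq h =>
    hq (congrArg Sigma.fst h)
  by_cases h3 : 3 ≤ (F i).rank
  · exact C_S_of_three hF ⟨i, ⟨0, by omega⟩⟩ ⟨i, ⟨1, by omega⟩⟩ ⟨i, ⟨2, by omega⟩⟩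
      (hne _ _ _ (by simp)) (hne _ _ _ (by simp)) (hne _ _ _ (by simp)) hi hi hi
  have hpos := (F i).rank_pos
  by_cases h2 : (F i).rank = 2
  · obtain ⟨j, hji, hj⟩ : ∃ j, j ≠ i ∧ (F j).IsOddO := by
      by_contra! hcon
      exact hA ⟨r, F, hF, i, hi, h2, hcon⟩
    exact C_S_of_three hF ⟨i, ⟨0, by omega⟩⟩ ⟨i, ⟨1, by omega⟩⟩ ⟨j, ⟨0, (F j).rank_pos⟩⟩
      (hne _ _ _ (by simp)) (hne' _ _ _ _ hji.symm) (hne' _ _ _ _ hji.symm) hi hi hj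
  have h1 : (F i).rank = 1 := by omega
  -- A single odd factor of rank 1 would contribute an odd dimension and all others an even one.
  obtain ⟨j, hji, hj⟩ : ∃ j, j ≠ i ∧ (F j).IsOddO := by
    by_contra! hcon
    have hcard := hF.card
    rw [← Finset.add_sum_erase _ _ (Finset.mem_univ i)] at hcard
    have heven : Even (∑ q ∈ Finset.univ.erase i, (F q).base.dim * (F q).rank * (F q).mult) :=
      Finset.even_sum _ fun q hq => Factor.even_of_not_isOddO (hcon q (Finset.ne_of_mem_erase hq))
    have hd : (F i).base.dim = 1 := by rw [hi.1]; rfl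
    rw [h1, hd, one_mul, one_mul] at hcard
    have := hi.2.add_even heven
    rw [← hcard] at this
    exact Nat.not_odd_iff_even.2 hn this
  by_cases h2 : 2 ≤ (F j).rank
  · exact C_S_of_three hF ⟨i, ⟨0, by omega⟩⟩ ⟨j, ⟨0, by omega⟩⟩ ⟨j, ⟨1, by omega⟩⟩
      (hne' _ _ _ _ hji.symm) (hne' _ _ _ _ hji.symm) (hne _ _ _ (by simp)) hi hj hj
  have h1j : (F j).rank = 1 := by have := (F j).rank_pos; omega
  obtain ⟨k, hki, hkj, hk⟩ : ∃ k, k ≠ i ∧ k ≠ j ∧ (F k).IsOddO := by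
    by_contra! hcon
    exact hB ⟨r, F, hF, i, j, hji.symm, hi, h1, hj, h1j, hcon⟩
  exact C_S_of_three hF ⟨i, ⟨0, by omega⟩⟩ ⟨j, ⟨0, by omega⟩⟩ ⟨k, ⟨0, (F k).rank_pos⟩⟩
    (hne' _ _ _ _ hji.symm) (hne' _ _ _ _ hki.symm) (hne' _ _ _ _ hkj.symm) hi hj hk

end Coordinates

/-! ### Quarter turns -/

section QuarterTurn

open Matrix

variable {κ : Type*} [Fintype κ] [DecidableEq κ]

/-- The rotation by a right angle in the plane spanned by two basis vectors. -/
def quarterTurn (x y : κ) : Matrix κ κ ℝ :=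
  diagonal (Function.update 1 x (-1)) * (1 : Matrix κ κ ℝ).submatrix (Equiv.swap x y) id

theorem permute_mul (σ : Equiv.Perm κ) (Z : Matrix κ κ ℝ) :
    (1 : Matrix κ κ ℝ).submatrix σ id * Z = Z.submatrix σ id :=
  one_submatrix_mul σ (Equiv.refl κ) Z

theorem quarterTurn_mul_apply (x y : κ) (Z : Matrix κ κ ℝ) (k l : κ) :
    (quarterTurn x y * Z) k l =
      (Function.update 1 x (-1) : κ → ℝ) k * Z (Equiv.swap x y k) l := by
  rw [quarterTurn, Matrix.mul_assoc, diagonal_mul, permute_mul]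
  rfl

theorem mul_quarterTurn_apply (x y : κ) (Z : Matrix κ κ ℝ) (k l : κ) :
    (Z * quarterTurn x y) k l =
      Z k (Equiv.swap x y l) * (Function.update 1 x (-1) : κ → ℝ) (Equiv.swap x y l) := by
  rw [quarterTurn, ← Matrix.mul_assoc, mul_submatrix_one, submatrix_apply, mul_diagonal]
  rfl

theorem quarterTurn_apply_same {x y : κ} : quarterTurn x y x y = -1 := by
  rw [← Matrix.mul_one (quarterTurn x y), quarterTurn_mul_apply, Equiv.swap_apply_left,
    one_apply_eq, mul_one, Function.update_self]

theorem quarterTurn_mem_orthogonalGroup {x y : κ} : quarterTurn x y ∈ orthogonalGroup κ ℝ := by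
  refine mul_mem ?_ ?_
  · rw [mem_orthogonalGroup_iff, diagonal_transpose, diagonal_mul_diagonal, ← diagonal_one]
    congr 1
    funext k
    by_cases hk : k = x <;> simp [hk]
  · rw [mem_orthogonalGroup_iff, transpose_submatrix, permute_mul, transpose_one]
    ext k l
    simp [one_apply]

theorem det_quarterTurn {x y : κ} (hxy : x ≠ y) : (quarterTurn x y).det = 1 := by
  rw [quarterTurn, det_mul, det_diagonal, det_permute, det_one, Equiv.Perm.sign_swap hxy,
    Finset.prod_update_of_mem (Finset.mem_univ x)]
  simp

/-- The hypotheses say that Z preserves the coordinate plane and its complement and acts on the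
plane as a multiple of a rotation. -/
theorem commute_quarterTurn {x y : κ} (hxy : x ≠ y) {Z : Matrix κ κ ℝ}
    (h0 : ∀ k, k ≠ x → k ≠ y → Z k x = 0 ∧ Z k y = 0 ∧ Z x k = 0 ∧ Z y k = 0)
    (h1 : Z x x = Z y y) (h2 : Z x y = -Z y x) :
    Z * quarterTurn x y = quarterTurn x y * Z := by
  ext k l
  rw [mul_quarterTurn_apply, quarterTurn_mul_apply]
  have hswap : ∀ k, k ≠ x → k ≠ y → Equiv.swap x y k = k := fun k => Equiv.swap_apply_of_ne_of_ne
  by_cases hkx : k = x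
  · subst hkx
    by_cases hlx : l = k
    · subst hlx
      simp [hxy.symm, h2]
    by_cases hly : l = y
    · subst hly
      simp [h1]
    simp [hswap l hlx hly, h0 l hlx hly]
  by_cases hky : k = y
  · subst hky
    by_cases hlx : l = x
    · subst hlx
      simp [hxy.symm, h1]
    by_cases hly : l = k
    · subst hly
      simp [h2, hxy.symm]
    simp [hswap l hlx hly, h0 l hlx hly]
  by_cases hlx : l = x
  · subst hlx
    simp [hswap k hkx hky, h0 k hkx hky]
  by_cases hly : l = y
  · subst hly
    simp [hswap k hkx hky, h0 k hkx hky]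
  simp [hswap k hkx hky, hswap l hlx hly, hkx, hlx]

end QuarterTurn

/-! ### Cases (A) and (B) obstruct admissibility -/

section Cases

open Matrix

variable {n r : ℕ} {H : Subgroup (O n)} {F : Fin r → Factor}

/-- The quarter turn has determinant 1 and centralizes `S H`, but not H: the reflection in the
coordinate of x negates x and fixes y. -/
theorem S_C_S_ne_of_commute_quarterTurn (h : HasFactors H F) (x y : Σ i, (F i).Index)
    (hxy : (⟨x.1, x.2.1.2⟩ : Σ i, Fin (F i).rank) ≠ ⟨y.1, y.2.1.2⟩)
    (hcomm : ∀ A : (i : Fin r) → Matrix (F i).Index (F i).Index ℝ, (∀ i, A i ∈ (F i).matrices) →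
      ∏ i, (A i).det = 1 →
      blockDiagonal' A * quarterTurn x y = quarterTurn x y * blockDiagonal' A) :
    S (C (S H)) ≠ S (C H) := by
  intro heq
  have hne : x ≠ y := fun h => hxy (by rw [h])
  obtain ⟨ψ, hdet, hψ⟩ := h.exists_coordinates
  obtain ⟨z, hz⟩ : ∃ z : O n, (ψ z).1 = quarterTurn x y :=
    ⟨ψ.symm ⟨_, quarterTurn_mem_orthogonalGroup⟩, congrArg Subtype.val (ψ.apply_symm_apply _)⟩
  have hzS : z ∈ S (C (S H)) := by
    refine mem_S.2 ⟨?_, mem_C.2 fun g hg => ?_⟩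
    · rw [mem_SO, ← hdet, hz, det_quarterTurn hne]
    · obtain ⟨hg1, hg2⟩ := mem_S.1 hg
      obtain ⟨A, hA, hgA⟩ := (hψ g).1 hg2
      rw [mem_SO, ← hdet, hgA, det_blockDiagonal_sigma] at hg1
      refine ψ.injective (Subtype.ext ?_)
      rw [map_mul, map_mul, Submonoid.coe_mul, Submonoid.coe_mul, hz, hgA]
      exact hcomm A hA hg1
  rw [heq] at hzS
  set β : Σ i, Fin (F i).rank := ⟨x.1, x.2.1.2⟩ with hβ
  obtain ⟨g, hg⟩ : ∃ g : O n, (ψ g).1 = diagonal (reflectionSign F β) :=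
    ⟨ψ.symm ⟨_, reflection_mem_orthogonalGroup β⟩, congrArg Subtype.val (ψ.apply_symm_apply _)⟩
  have hgH : g ∈ H :=
    (hψ g).2 ⟨_, diagonal_reflectionSign_mem β, hg.trans (diagonal_reflectionSign β)⟩
  have h1 := congrArg (fun t => (ψ t).1) (mem_C.1 (mem_S.1 hzS).2 g hgH)
  simp only [map_mul, Submonoid.coe_mul] at h1
  rw [hz, hg] at h1
  have h2 := congrFun (congrFun h1 x) y
  rw [diagonal_mul, mul_diagonal, quarterTurn_apply_same, reflectionSign, reflectionSign,
    if_pos hβ.symm, if_neg hxy.symm] at h2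
  norm_num at h2

theorem rotation_entries {m : ℕ} (hm : m = 2) (a : Matrix (Fin m) (Fin m) ℝ) (ha : a * aᵀ = 1)
    (hd : a.det = 1) : a ⟨0, by omega⟩ ⟨0, by omega⟩ = a ⟨1, by omega⟩ ⟨1, by omega⟩ ∧
      a ⟨0, by omega⟩ ⟨1, by omega⟩ = -a ⟨1, by omega⟩ ⟨0, by omega⟩ := by
  subst hm
  have h0 := congrFun (congrFun ha 0) 0
  have h1 := congrFun (congrFun ha 1) 1
  simp only [Matrix.mul_apply, Fin.sum_univ_two, transpose_apply, one_apply_eq] at h0 h1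
  rw [det_fin_two] at hd
  -- The left side is the squared Frobenius norm minus twice the determinant, that is 2 - 2.
  have h : (a 0 0 - a 1 1) ^ 2 + (a 0 1 + a 1 0) ^ 2 = 0 := by linear_combination h0 + h1 - 2 * hd
  have h2 : (a 0 0 - a 1 1) ^ 2 = 0 := by nlinarith [sq_nonneg (a 0 1 + a 1 0)]
  have h3 : (a 0 1 + a 1 0) ^ 2 = 0 := by nlinarith [sq_nonneg (a 0 0 - a 1 1)]
  exact ⟨sub_eq_zero.1 (pow_eq_zero_iff two_ne_zero |>.1 h2),
    eq_neg_of_add_eq_zero_left (pow_eq_zero_iff two_ne_zero |>.1 h3)⟩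

theorem det_of_rank_one {m : ℕ} (hm : m = 1) (a : Matrix (Fin m) (Fin m) ℝ) :
    a.det = a ⟨0, by omega⟩ ⟨0, by omega⟩ := by
  subst hm
  exact det_fin_one a

theorem Factor.IsOddO.eq_zero {F : Factor} (hF : F.IsOddO) (s : Fin F.base.dim) :
    s = ⟨0, F.base.dim_pos⟩ := by
  have hd : F.base.dim = 1 := by rw [hF.1]; rfl
  have := s.2
  exact Fin.ext (by simp only; omega)

/-- On `S H` the O(2)-block has determinant 1, so it is a rotation and commutes with the quarter
turn in one copy of the plane. -/
theorem CaseA.S_C_S_ne (h : CaseA H) : S (C (S H)) ≠ S (C H) := by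
  obtain ⟨r, F, hF, i, hi, hrank, hother⟩ := h
  have h0 : 0 < (F i).rank := (F i).rank_pos
  have h1 : 1 < (F i).rank := by omega
  let x : (F i).Index := ((⟨0, (F i).base.dim_pos⟩, ⟨0, h0⟩), ⟨0, (F i).mult_pos⟩)
  let y : (F i).Index := ((⟨0, (F i).base.dim_pos⟩, ⟨1, h1⟩), ⟨0, (F i).mult_pos⟩)
  refine S_C_S_ne_of_commute_quarterTurn hF ⟨i, x⟩ ⟨i, y⟩ (by simp [x, y]) fun A hA hdet => ?_
  rw [Fintype.prod_eq_single i fun j hj => Factor.det_eq_one (hA j) (hother j hj)] at hdet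
  obtain ⟨a, ha, had, hAa⟩ := Factor.exists_of_isOddO hi (hA i)
  obtain ⟨e1, e2⟩ := rotation_entries hrank a ha (had ▸ hdet)
  refine commute_quarterTurn (by simp [x, y]) ?_ ?_ ?_
  · rintro ⟨j, ⟨s, b⟩, t⟩ hx hy
    by_cases hj : j = i
    · subst hj
      have ht : t ≠ ⟨0, (F j).mult_pos⟩ := by
        rintro rfl
        rw [hi.eq_zero s] at hx hy
        have hb : b = ⟨0, h0⟩ ∨ b = ⟨1, h1⟩ := by
          have := b.2
          simp only [Fin.ext_iff]
          omega
        rcases hb with rfl | rfl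
        · exact hx rfl
        · exact hy rfl
      simp only [blockDiagonal'_apply_eq, hAa]
      simp [x, y, ht, ht.symm]
    · simp [blockDiagonal'_apply_ne, hj, Ne.symm hj]
  · simpa only [blockDiagonal'_apply_eq, hAa, x, y, if_true] using e1
  · simpa only [blockDiagonal'_apply_eq, hAa, x, y, if_true] using e2

/-- On `S H` the signs on the two O(1)-blocks have product 1, so they agree, and the group acts by
scalars on a plane with one basis vector from each block. -/
theorem CaseB.S_C_S_ne (h : CaseB H) : S (C (S H)) ≠ S (C H) := by
  obtain ⟨r, F, hF, i, i', hii, hi, hrank, hi', hrank', hother⟩ := h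
  let x : ∀ j, (F j).Index := fun j =>
    ((⟨0, (F j).base.dim_pos⟩, ⟨0, (F j).rank_pos⟩), ⟨0, (F j).mult_pos⟩)
  refine S_C_S_ne_of_commute_quarterTurn hF ⟨i, x i⟩ ⟨i', x i'⟩
    (fun h => hii (congrArg Sigma.fst h)) fun A hA hdet => ?_
  rw [Fintype.prod_eq_mul i i' hii fun j hj =>
    Factor.det_eq_one (hA j) (hother j hj.1 hj.2)] at hdet
  -- A block of rank 1 is its determinant times the identity.
  have hblock : ∀ j, (F j).IsOddO → (F j).rank = 1 → ∀ y,
      A j (x j) y = (if x j = y then (A j).det else 0) ∧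
        A j y (x j) = if x j = y then (A j).det else 0 := by
    intro j hj hr y
    obtain ⟨a, -, had, hAa⟩ := Factor.exists_of_isOddO hj (hA j)
    rw [had, det_of_rank_one hr, hAa, hAa]
    obtain ⟨⟨s, b⟩, t⟩ := y
    have hb : b = ⟨0, (F j).rank_pos⟩ := by
      have := b.2
      exact Fin.ext (by simp only; omega)
    rw [hj.eq_zero s, hb]
    simp [x, eq_comm]
  have hne : i' ≠ i := hii.symm
  refine commute_quarterTurn (fun h => hii (congrArg Sigma.fst h)) ?_ ?_ ?_
  · rintro ⟨j, y⟩ hx hy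
    by_cases hj : j = i
    · subst hj
      have hxy : x j ≠ y := fun h => hx (by rw [h])
      simp [blockDiagonal'_apply_ne, hblock j hi hrank, hxy, hii, hne]
    by_cases hj' : j = i'
    · subst hj'
      have hxy : x j ≠ y := fun h => hy (by rw [h])
      simp [blockDiagonal'_apply_ne, hblock j hi' hrank', hxy, hii, hne]
    simp [blockDiagonal'_apply_ne, hj, hj', Ne.symm hj, Ne.symm hj']
  · rw [blockDiagonal'_apply_eq, blockDiagonal'_apply_eq, (hblock i hi hrank _).1,
      (hblock i' hi' hrank' _).1, if_pos rfl, if_pos rfl]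
    rcases det_eq_one_or_of_mul_transpose ((Factor.mem_matrices_iff _ _).1 (hA i)).1 with h | h <;>
      rw [h] at hdet ⊢ <;> linarith
  · rw [blockDiagonal'_apply_ne _ _ _ hii, blockDiagonal'_apply_ne _ _ _ hne, neg_zero]

/-- The cases for `C H` enter through the second equation of `isSAdmissible_iff`, which reads `S (C
(S (C H))) = S (C (C H))`. -/
theorem isSAdmissible_iff_of_even (hn : Even n) (hH : IsHowe H) :
    IsSAdmissible H ↔ ¬ (CaseA H ∨ CaseB H) ∧ ¬ (CaseA (C H) ∨ CaseB (C H)) := by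
  rw [isSAdmissible_iff hH]
  constructor
  · rintro ⟨h1, h2⟩
    refine ⟨fun h => ?_, fun h => ?_⟩
    · exact h.elim CaseA.S_C_S_ne CaseB.S_C_S_ne (by rw [h1])
    · exact h.elim CaseA.S_C_S_ne CaseB.S_C_S_ne (by rw [h2, hH.C_C])
  · rintro ⟨h1, h2⟩
    rw [not_or] at h1 h2
    refine ⟨C_S_of_not_case hn hH h1.1 h1.2, ?_⟩
    rw [C_S_of_not_case hn (isHowe_C H) h2.1 h2.2, hH.C_C]

end Cases

end Howe

theorem proposition3p2 (n : ℕ) :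
    -- intersection with `SO(n)` and the map `M`
    (Set.BijOn Howe.S {H : Subgroup (Howe.O n) | Howe.IsSAdmissible H}
        {H : Subgroup (Howe.O n) | Howe.IsHoweSO H} ∧
      Set.InvOn Howe.M Howe.S {H : Subgroup (Howe.O n) | Howe.IsSAdmissible H}
        {H : Subgroup (Howe.O n) | Howe.IsHoweSO H}) ∧
    -- the S-admissible Howe subgroups for even `n`
    (Even n → ∀ H : Subgroup (Howe.O n), Howe.IsHowe H →
      (Howe.IsSAdmissible H ↔
        ¬ (Howe.CaseA H ∨ Howe.CaseB H) ∧
          ¬ (Howe.CaseA (Howe.C H) ∨ Howe.CaseB (Howe.C H)))) ∧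
    -- odd `n`
    (Odd n →
      Set.BijOn Howe.S {H : Subgroup (Howe.O n) | Howe.IsHowe H}
        {H : Subgroup (Howe.O n) | Howe.IsHoweSO H} ∧
      Set.InvOn Howe.centerMul Howe.S {H : Subgroup (Howe.O n) | Howe.IsHowe H}
        {H : Subgroup (Howe.O n) | Howe.IsHoweSO H} ∧
      ∀ H K : Subgroup (Howe.O n), Howe.IsHowe H → Howe.IsHowe K →
        (Howe.IsConjSubgroup H K ↔
          Howe.IsConjSubgroup ((Howe.S H).subgroupOf (Howe.SO n))
            ((Howe.S K).subgroupOf (Howe.SO n)))) :=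
  ⟨Howe.bijOn_S_isSAdmissible n, fun hn _ hH => Howe.isSAdmissible_iff_of_even hn hH, fun hn =>
    ⟨(Howe.bijOn_S_isHowe hn).1, (Howe.bijOn_S_isHowe hn).2, fun _ _ hH hK =>
      Howe.isConjSubgroup_S_iff hn hH hK⟩⟩
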